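/- Let $\mathcal{N}_{A\to B}$ and $\mathcal{M}_{A\to B}$ be quantum channels (completely positive trace-preserving maps) between finite-dimensional systems, with $\dim A\ge 1$, and let $p\in(0,1)$. \emph{Discrimination.} For $n\ge1$, a sequential strategy with $n$ channel calls consists of finite-dimensional memory systems $R_1,\dots,R_n$, a state $\rho_{R_1A}$ and channels $\mathcal{S}^i_{R_iB\to R_{i+1}A}$, $1\le i\le n-1$. Its final state on $R_nB$ under the channel $\mathcal{K}\in\{\mathcal{N},\mathcal{M}\}$ is $$\omega^{\mathcal{K}}=(\mathcal{K}_{A\to B}\circ\mathcal{S}^{n-1}\circ\cdots\circ\mathcal{S}^1\circ\mathcal{K}_{A\to B})(\rho_{R_1A}).$$ Let $$p_e^{(n)}:=\inf\left\{p\operatorname{Tr}[(I-\Lambda)\omega^{\mathcal{N}}]+(1-p)\operatorname{Tr}[\Lambda\omega^{\mathcal{M}}]\right\},$$ where the infimum is over all such strategies and all $0\le\Lambda\le I$ on $R_nB$. Put $\xi_n(p,\mathcal{N},\mathcal{M}):=-\frac1n\ln p_e^{(n)}\in[0,+\infty]$ (the non-asymptotic Chernoff exponent) and $\overline{\xi}(\mathcal{N},\mathcal{M}):=\limsup_{n\to\infty}\xi_n(p,\mathcal{N},\mathcal{M})$.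 \emph{Geometric R\'enyi relative entropy.} For a state $\rho$ and $\sigma\ge0$, with $\sigma_\varepsilon:=\sigma+\varepsilon I$, let $$\widehat D_{1/2}(\rho\Vert\sigma):=-2\ln\lim_{\varepsilon\to0^+}\operatorname{Tr}\!\left[\sigma_\varepsilon\left(\sigma_\varepsilon^{-1/2}\rho\,\sigma_\varepsilon^{-1/2}\right)^{1/2}\right]\qquad(-2\ln 0:=+\infty),$$ and $\widehat D_{1/2}(\mathcal{N}\Vert\mathcal{M}):=\sup_{\rho_{RA}}\widehat D_{1/2}(\mathcal{N}_{A\to B}(\rho_{RA})\Vert\mathcal{M}_{A\to B}(\rho_{RA}))$, where the supremum is over all finite-dimensional $R$ and all states $\rho_{RA}$. \emph{Claim.} For every $p\in(0,1)$ and every $n\ge1$, $$\xi_n(p,\mathcal{N},\mathcal{M})\le\widehat D_{1/2}(\mathcal{N}\Vert\mathcal{M})-\frac1n\ln[p(1-p)],$$ and consequently $\overline{\xi}(\mathcal{N},\mathcal{M})\le\widehat D_{1/2}(\mathcal{N}\Vert\mathcal{M})$. Moreover, this bound is single-letter and is given by a semi-definite program over a single use of the channels. Let $\Gamma^{\mathcal{N}}_{RB},\Gamma^{\mathcal{M}}_{RB}$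 be the Choi operators of the channels, with $R\cong A$. Then $\widehat D_{1/2}(\mathcal{N}\Vert\mathcal{M})=-2\ln s$ (read as $+\infty$ if $s=0$), where $$s=\sup\left\{\mu\ge0:\ \exists X_{RB}\ge0,\ \begin{bmatrix}\Gamma^{\mathcal{N}}_{RB}&X_{RB}\\X_{RB}&\Gamma^{\mathcal{M}}_{RB}\end{bmatrix}\ge0,\ \mu I_R\le\operatorname{Tr}_B[X_{RB}]\right\},$$ and $s$ is also the value of the dual program $$s=\inf\left\{\operatorname{Tr}[\Gamma^{\mathcal{N}}_{RB}Y_{RB}]+\operatorname{Tr}[\Gamma^{\mathcal{M}}_{RB}Z_{RB}]:\ \begin{bmatrix}Y_{RB}&W_{RB}^\dagger\\W_{RB}&Z_{RB}\end{bmatrix}\ge0,\ W_{RB}+W_{RB}^\dagger\ge\rho_R\otimes I_B,\ \rho_R\ge0,\ \operatorname{Tr}[\rho_R]=1\right\}.$$ -/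

import Mathlib

open scoped ENNReal Topology ComplexOrder Kronecker

noncomputable section

namespace ChannelDiscrimination

/-- A quantum state (density operator) on the finite-dimensional system with basis `ι`. -/
def IsState {ι : Type*} [Fintype ι] (ρ : Matrix ι ι ℂ) : Prop :=
  ρ.PosSemidef ∧ ρ.trace = 1

/-- The map `id_R ⊗ Φ`: `Φ` is applied to the `A`-system of an operator on `R ⊗ A`. -/
def ampl {A B : Type*} (R : Type*) (Φ : Matrix A A ℂ →ₗ[ℂ] Matrix B B ℂ)
    (X : Matrix (R × A) (R × A) ℂ) : Matrix (R × B) (R × B) ℂ :=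
  Matrix.of fun i j => Φ (Matrix.of fun a a' => X (i.1, a) (j.1, a')) i.2 j.2

/-- Complete positivity: `id_R ⊗ Φ` preserves positive semi-definiteness for every finite `R`. -/
def IsCompletelyPositive {A B : Type*} (Φ : Matrix A A ℂ →ₗ[ℂ] Matrix B B ℂ) : Prop :=
  ∀ (d : ℕ) (X : Matrix (Fin d × A) (Fin d × A) ℂ), X.PosSemidef → (ampl (Fin d) Φ X).PosSemidef

/-- A quantum channel: a completely positive, trace-preserving linear map. -/
def IsChannel {A B : Type*} [Fintype A] [Fintype B]
    (Φ : Matrix A A ℂ →ₗ[ℂ] Matrix B B ℂ) : Prop :=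
  IsCompletelyPositive Φ ∧ ∀ X, (Φ X).trace = X.trace

/-- A sequential (adaptive) strategy making `n` calls to an unknown channel from `A` to `B`, without
its final measurement. The memory systems are `R_{i+1} = ℂ^(mem i)`; the strategy prepares a state
of `R_1 A` and applies the channel `interleave i` from `R_{i+1} B` to `R_{i+2} A` between call
`i + 1` and call `i + 2`. Only the `n - 1` maps `interleave i` with `i + 1 < n` are ever used. -/
structure Strategy (A B : Type*) [Fintype A] [Fintype B] (n : ℕ) where
  mem : ℕ → ℕ
  input : Matrix (Fin (mem 0) × A) (Fin (mem 0) × A) ℂ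
  input_isState : IsState input
  interleave : ∀ i : ℕ, Matrix (Fin (mem i) × B) (Fin (mem i) × B) ℂ →ₗ[ℂ]
    Matrix (Fin (mem (i + 1)) × A) (Fin (mem (i + 1)) × A) ℂ
  interleave_isChannel : ∀ i : ℕ, i + 1 < n → IsChannel (interleave i)

/-- The state of `R_{k+1} B` right after call number `k + 1` of the channel `Φ`. -/
def Strategy.stateAfter {A B : Type*} [Fintype A] [Fintype B] {n : ℕ} (S : Strategy A B n)
    (Φ : Matrix A A ℂ →ₗ[ℂ] Matrix B B ℂ) :
    ∀ k : ℕ, Matrix (Fin (S.mem k) × B) (Fin (S.mem k) × B) ℂ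
  | 0 => ampl (Fin (S.mem 0)) Φ S.input
  | k + 1 => ampl (Fin (S.mem (k + 1))) Φ (S.interleave k (S.stateAfter Φ k))

/-- The state at the end of the protocol, after all `n ≥ 1` calls and before the measurement. -/
def Strategy.finalState {A B : Type*} [Fintype A] [Fintype B] {n : ℕ} (S : Strategy A B n)
    (Φ : Matrix A A ℂ →ₗ[ℂ] Matrix B B ℂ) :
    Matrix (Fin (S.mem (n - 1)) × B) (Fin (S.mem (n - 1)) × B) ℂ :=
  S.stateAfter Φ (n - 1)

/-- A binary measurement `{Λ, I - Λ}`, given by its first element; outcome `Λ` is the guess that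
the unknown channel is the first one. -/
def IsTest {ι : Type*} [Fintype ι] [DecidableEq ι] (Λ : Matrix ι ι ℂ) : Prop :=
  Λ.PosSemidef ∧ (1 - Λ).PosSemidef

/-- The expected error probability `p α_n + (1 - p) β_n` of the strategy `S` with final measurement
`{Λ, I - Λ}`, where `α_n = Tr[(I - Λ) ω^N]` and `β_n = Tr[Λ ω^M]`. -/
def errorProb {A B : Type*} [Fintype A] [Fintype B] [DecidableEq B] {n : ℕ}
    (p : ℝ) (N M : Matrix A A ℂ →ₗ[ℂ] Matrix B B ℂ) (S : Strategy A B n)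
    (Λ : Matrix (Fin (S.mem (n - 1)) × B) (Fin (S.mem (n - 1)) × B) ℂ) : ℝ :=
  p * (((1 - Λ) * S.finalState N).trace).re + (1 - p) * ((Λ * S.finalState M).trace).re

/-- The optimal expected error probability over all sequential strategies with `n` calls and all
final measurements. -/
def optErrorProb {A B : Type*} [Fintype A] [Fintype B] [DecidableEq B]
    (n : ℕ) (p : ℝ) (N M : Matrix A A ℂ →ₗ[ℂ] Matrix B B ℂ) : ℝ :=
  sInf {e : ℝ | ∃ (S : Strategy A B n)
    (Λ : Matrix (Fin (S.mem (n - 1)) × B) (Fin (S.mem (n - 1)) × B) ℂ),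
    IsTest Λ ∧ e = errorProb p N M S Λ}

/-- The non-asymptotic Chernoff exponent `-(1/n) ln p_e^(n)`, equal to `+∞` when the optimal error
probability vanishes. -/
def chernoffExponent {A B : Type*} [Fintype A] [Fintype B] [DecidableEq B]
    (n : ℕ) (p : ℝ) (N M : Matrix A A ℂ →ₗ[ℂ] Matrix B B ℂ) : EReal :=
  ((-(1 / (n : ℝ)) : ℝ) : EReal) * ENNReal.log (ENNReal.ofReal (optErrorProb n p N M))

/-- The asymptotic Chernoff exponent `limsup_n ξ_n`. -/
def asymptoticChernoffExponent {A B : Type*} [Fintype A] [Fintype B] [DecidableEq B]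
    (p : ℝ) (N M : Matrix A A ℂ →ₗ[ℂ] Matrix B B ℂ) : EReal :=
  Filter.limsup (fun n : ℕ => chernoffExponent n p N M) Filter.atTop

/-- The power `X ^ α` of a positive semi-definite matrix, through its spectral decomposition. -/
def mpow {ι : Type*} [Fintype ι] [DecidableEq ι] (X : Matrix ι ι ℂ) (α : ℝ) : Matrix ι ι ℂ :=
  cfc (fun x : ℝ => x ^ α) X

/-- The geometric Rényi relative quasi-entropy
`lim_{ε → 0⁺} Tr[σ_ε (σ_ε^(-1/2) ρ σ_ε^(-1/2))^α]` with `σ_ε = σ + ε I`. -/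
def geometricQuasi {ι : Type*} [Fintype ι] [DecidableEq ι] (α : ℝ) (ρ σ : Matrix ι ι ℂ) : ℝ≥0∞ :=
  Filter.limUnder (𝓝[>] (0 : ℝ)) fun ε : ℝ =>
    let σε : Matrix ι ι ℂ := σ + (ε : ℂ) • (1 : Matrix ι ι ℂ)
    ENNReal.ofReal
      ((σε * mpow (mpow σε (-(1 / 2)) * ρ * mpow σε (-(1 / 2))) α).trace).re

/-- The geometric Rényi relative entropy `(1 / (α - 1)) ln Q̂_α(ρ‖σ)`, with values in `[-∞, +∞]`. -/
def geometricRenyi {ι : Type*} [Fintype ι] [DecidableEq ι] (α : ℝ) (ρ σ : Matrix ι ι ℂ) : EReal :=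
  ((1 / (α - 1) : ℝ) : EReal) * ENNReal.log (geometricQuasi α ρ σ)

/-- The geometric Rényi relative entropy of channels: the supremum of
`D̂_α(N(ρ_RA) ‖ M(ρ_RA))` over all states `ρ_RA` and all finite-dimensional `R`. -/
def channelGeometricRenyi {A B : Type*} [Fintype A] [Fintype B] [DecidableEq B]
    (α : ℝ) (N M : Matrix A A ℂ →ₗ[ℂ] Matrix B B ℂ) : EReal :=
  ⨆ (d : ℕ) (ρ : Matrix (Fin d × A) (Fin d × A) ℂ) (_ : IsState ρ),
    geometricRenyi α (ampl (Fin d) N ρ) (ampl (Fin d) M ρ)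

/-- The unnormalized maximally entangled operator `|Γ⟩⟨Γ|` on `R ⊗ A` with `R = A`, where
`|Γ⟩ = ∑ i, |i⟩|i⟩`. -/
def maxEntangled (A : Type*) [DecidableEq A] : Matrix (A × A) (A × A) ℂ :=
  Matrix.of fun i j => if i.1 = i.2 ∧ j.1 = j.2 then 1 else 0

/-- The Choi operator `(id_R ⊗ Φ)(|Γ⟩⟨Γ|)`. -/
def choi {A B : Type*} [DecidableEq A] (Φ : Matrix A A ℂ →ₗ[ℂ] Matrix B B ℂ) :
    Matrix (A × B) (A × B) ℂ :=
  ampl A Φ (maxEntangled A)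

/-- The partial trace over the second system. -/
def partialTraceRight {A B : Type*} [Fintype B] (X : Matrix (A × B) (A × B) ℂ) : Matrix A A ℂ :=
  Matrix.of fun a a' => ∑ b, X (a, b) (a', b)

/-- The objective values of the primal semi-definite program: all `μ ≥ 0` for which there is
`X ≥ 0` with `[[Γ^N, X], [X, Γ^M]] ≥ 0` and `μ I ≤ Tr_B X`. -/
def primalValues {A B : Type*} [Fintype B] [DecidableEq A]
    (N M : Matrix A A ℂ →ₗ[ℂ] Matrix B B ℂ) : Set ℝ :=
  {μ : ℝ | 0 ≤ μ ∧ ∃ X : Matrix (A × B) (A × B) ℂ, X.PosSemidef ∧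
    (Matrix.fromBlocks (choi N) X X (choi M)).PosSemidef ∧
    (partialTraceRight X - (μ : ℂ) • (1 : Matrix A A ℂ)).PosSemidef}

/-- The objective values of the dual semi-definite program: all `Tr[Γ^N Y] + Tr[Γ^M Z]` with
`[[Y, W†], [W, Z]] ≥ 0` and `W + W† ≥ ρ ⊗ I` for some `ρ ≥ 0` with `Tr ρ = 1`. -/
def dualValues {A B : Type*} [Fintype A] [Fintype B] [DecidableEq A] [DecidableEq B]
    (N M : Matrix A A ℂ →ₗ[ℂ] Matrix B B ℂ) : Set ℝ :=
  {v : ℝ | ∃ (ρ : Matrix A A ℂ) (Y W Z : Matrix (A × B) (A × B) ℂ), IsState ρ ∧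
    (Matrix.fromBlocks Y W.conjTranspose W Z).PosSemidef ∧
    (W + W.conjTranspose - ρ ⊗ₖ (1 : Matrix B B ℂ)).PosSemidef ∧
    v = ((choi N * Y).trace + (choi M * Z).trace).re}

end ChannelDiscrimination

end

/-! At order 1/2 the quasi-entropy is the trace of the matrix geometric mean of `P` and `Q`, and
that trace is a maximum: it is the largest `Tr X` with `X ≥ 0` and `[[P, X], [X, Q]] ≥ 0`
(`isGreatest_subMeanTraces`; `geometricQuasi_half` treats singular `Q` by compactness). Such a
witness `X` can be carried through a protocol.

A feasible `T` of the primal program is a witness for the two Choi operators. Contracting it with a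
witness for the inputs of a call gives a witness for the outputs, and `μ I ≤ Tr_B T` makes the trace
grow by a factor of at least `μ` (`exists_isSubMean_ampl`). The interleaved channels preserve
witnesses and their traces. Hence after `n` calls, whatever the strategy, there is a witness of
trace at least `μ ^ n`. Cauchy-Schwarz turns it into an error of at least `p (1 - p) μ ^ (2n)`
(`error_ge_of_isSubMean`), and taking logarithms gives the bound with `-2 ln s`.

It remains to identify `-2 ln s` with the channel divergence. One call on any input shows that the
divergence is at most this. Conversely, a dual feasible point with invertible `ρ` bounds the mean of
the two outputs of a purification of `ρ`, since these outputs are invertible congruences of the Choi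
operators (`exists_state_le_of_dual`). Strong duality is a Hahn-Banach separation
(`exists_dual_of_not_exists_primal`). -/

namespace ChannelDiscrimination

open Matrix Filter

/-! ### Positive block matrices and operators below a geometric mean. -/

section PosSemidef

variable {m n : Type*} [Fintype m] [Fintype n]

theorem re_trace_mul_nonneg {P Q : Matrix n n ℂ} (hP : P.PosSemidef) (hQ : Q.PosSemidef) :
    0 ≤ (P * Q).trace.re := by
  classical
  obtain ⟨K, rfl⟩ : ∃ K : Matrix n n ℂ, P = Kᴴ * K := by
    open scoped MatrixOrder in
    obtain ⟨K, hK⟩ := CStarAlgebra.nonneg_iff_eq_star_mul_self.mp hP.nonneg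
    exact ⟨K, hK⟩
  rw [Matrix.mul_assoc, Matrix.trace_mul_comm]
  exact (Complex.nonneg_iff.mp (hQ.mul_mul_conjTranspose_same K).trace_nonneg).1

theorem isClosed_setOf_posSemidef : IsClosed {P : Matrix n n ℂ | P.PosSemidef} := by
  simp only [posSemidef_iff_dotProduct_mulVec, Set.ofPred_and, Set.ofPred_forall]
  refine IsClosed.inter ?_ (isClosed_iInter fun x => ?_)
  · exact isClosed_eq (by fun_prop) continuous_id
  · exact isClosed_Ici.preimage (f := fun P : Matrix n n ℂ => star x ⬝ᵥ (P *ᵥ x)) (by fun_prop)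

/-- The congruence of a block matrix by `diag(K, L)`. -/
theorem fromBlocks_congr_posSemidef {P X Y Q : Matrix n n ℂ} (K : Matrix m n ℂ)
    (h : (fromBlocks P X Y Q).PosSemidef) :
    (fromBlocks (K * P * Kᴴ) (K * X * Kᴴ) (K * Y * Kᴴ) (K * Q * Kᴴ)).PosSemidef := by
  have := h.mul_mul_conjTranspose_same (fromBlocks K 0 0 K)
  simpa [fromBlocks_multiply, fromBlocks_conjTranspose] using this

/-- Compression of a block matrix by the row `(a, b)`. -/
theorem fromBlocks_compress_posSemidef {P X Y Q : Matrix n n ℂ}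
    (h : (fromBlocks P X Y Q).PosSemidef) (a b : ℝ) :
    ((a ^ 2 : ℂ) • P + (a * b : ℂ) • X + (a * b : ℂ) • Y + (b ^ 2 : ℂ) • Q).PosSemidef := by
  classical
  have := h.mul_mul_conjTranspose_same
    (fromCols ((a : ℂ) • (1 : Matrix n n ℂ)) ((b : ℂ) • (1 : Matrix n n ℂ)))
  rw [conjTranspose_fromCols_eq_fromRows_conjTranspose, fromCols_mul_fromBlocks,
    fromCols_mul_fromRows] at this
  convert this using 1
  simp [smul_smul, smul_add]
  module

omit [Fintype n] in
theorem posSemidef_of_fromBlocks₁₁ {P X Y Q : Matrix n n ℂ}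
    (h : (fromBlocks P X Y Q).PosSemidef) : P.PosSemidef := h.submatrix Sum.inl

omit [Fintype n] in
theorem posSemidef_of_fromBlocks₂₂ {P X Y Q : Matrix n n ℂ}
    (h : (fromBlocks P X Y Q).PosSemidef) : Q.PosSemidef := h.submatrix Sum.inr

/-- The Cauchy-Schwarz inequality for a positive block matrix and a positive weight. -/
theorem sq_re_trace_mul_le {P X Q T : Matrix n n ℂ} (h : (fromBlocks P X X Q).PosSemidef)
    (hT : T.PosSemidef) :
    (T * X).trace.re ^ 2 ≤ (T * P).trace.re * (T * Q).trace.re := by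
  -- Pairing `T` with the compression by the row `(t, 1)` gives a quadratic in `t` that is never
  -- negative, so its discriminant is at most zero.
  have key : ∀ t : ℝ, 0 ≤ (T * P).trace.re * (t * t) + (2 * (T * X).trace.re) * t
      + (T * Q).trace.re := fun t => by
    have := re_trace_mul_nonneg hT (fromBlocks_compress_posSemidef h t 1)
    simp [mul_add, ← Complex.ofReal_pow] at this
    linarith
  have := discrim_le_zero key
  rw [discrim] at this
  linarith

omit [Fintype n] in
-- This is the nonnegativity of the 2 × 2 principal minor on `i, j`. It bounds the corner of a
-- positive block matrix by the diagonal blocks, which is the source of all compactness below.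
theorem norm_sq_apply_le_of_posSemidef {P : Matrix n n ℂ} (h : P.PosSemidef) (i j : n) :
    ‖P i j‖ ^ 2 ≤ (P i i).re * (P j j).re := by
  classical
  have h2 := (h.submatrix ![i, j]).det_nonneg
  rw [det_fin_two] at h2
  have hji : P j i = star (P i j) := (h.1.apply j i).symm
  have hi := h.diag_nonneg (i := i)
  have hj := h.diag_nonneg (i := j)
  rw [Complex.nonneg_iff] at hi hj
  have := (Complex.nonneg_iff.mp h2).1
  simp [hji, ← hi.2, ← hj.2] at this
  rw [← Complex.normSq_eq_norm_sq, Complex.normSq_apply]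
  linarith

theorem re_apply_le_re_trace {P : Matrix n n ℂ} (h : P.PosSemidef) (i : n) :
    (P i i).re ≤ P.trace.re := by
  rw [Matrix.trace, Complex.re_sum]
  exact Finset.single_le_sum (f := fun i => (P.diag i).re)
    (fun j _ => (Complex.nonneg_iff.mp (h.diag_nonneg (i := j))).1) (Finset.mem_univ i)

/-- The corners of a sequence of positive block matrices with convergent diagonal blocks have a
convergent subsequence. -/
theorem exists_tendsto_subseq_of_fromBlocks {P X Y Q : ℕ → Matrix n n ℂ} {P₀ Q₀ : Matrix n n ℂ}
    (h : ∀ k, (fromBlocks (P k) (X k) (Y k) (Q k)).PosSemidef)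
    (hP : Tendsto P atTop (𝓝 P₀)) (hQ : Tendsto Q atTop (𝓝 Q₀)) :
    ∃ (X₀ : Matrix n n ℂ) (φ : ℕ → ℕ), StrictMono φ ∧ Tendsto (X ∘ φ) atTop (𝓝 X₀) := by
  have htr : Continuous fun T : Matrix n n ℂ => T.trace.re := by fun_prop
  have hlim : Tendsto (fun k => (P k).trace.re * (Q k).trace.re) atTop
      (𝓝 (P₀.trace.re * Q₀.trace.re)) :=
    ((htr.tendsto _).comp hP).mul ((htr.tendsto _).comp hQ)
  obtain ⟨C, hC⟩ := hlim.bddAbove_range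
  have hb : ∀ k i j, ‖X k i j‖ ≤ Real.sqrt C := fun k i j => by
    refine Real.le_sqrt_of_sq_le ?_
    have h1 := posSemidef_of_fromBlocks₁₁ (h k)
    have h2 := posSemidef_of_fromBlocks₂₂ (h k)
    have h3 := norm_sq_apply_le_of_posSemidef (h k) (Sum.inl i) (Sum.inr j)
    simp only [fromBlocks_apply₁₂, fromBlocks_apply₁₁, fromBlocks_apply₂₂] at h3
    refine h3.trans ((mul_le_mul (re_apply_le_re_trace h1 i) (re_apply_le_re_trace h2 j)
      (Complex.nonneg_iff.mp (h2.diag_nonneg (i := j))).1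
      (Complex.nonneg_iff.mp h1.trace_nonneg).1).trans (hC ⟨k, rfl⟩))
  have hK : IsCompact (Set.univ.pi fun _ : n => Set.univ.pi fun _ : n =>
      Metric.closedBall (0 : ℂ) (Real.sqrt C)) :=
    isCompact_univ_pi fun _ => isCompact_univ_pi fun _ => isCompact_closedBall _ _
  obtain ⟨X₀, -, φ, hφ, hX⟩ := IsCompact.tendsto_subseq
    (X := n → n → ℂ) hK (x := X) fun k i _ j _ => by
    simpa using hb k i j
  exact ⟨X₀, φ, hφ, hX⟩

/-- `X` lies below the geometric mean of `P` and `Q`: it is positive, and so is the block matrix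
`[[P, X], [X, Q]]`. -/
def IsSubMean (P X Q : Matrix n n ℂ) : Prop :=
  X.PosSemidef ∧ (fromBlocks P X X Q).PosSemidef

theorem exists_isSubMean_of_tendsto {P X Q : ℕ → Matrix n n ℂ} {P₀ Q₀ : Matrix n n ℂ}
    (h : ∀ k, IsSubMean (P k) (X k) (Q k))
    (hP : Tendsto P atTop (𝓝 P₀)) (hQ : Tendsto Q atTop (𝓝 Q₀)) :
    ∃ (X₀ : Matrix n n ℂ) (φ : ℕ → ℕ), StrictMono φ ∧ Tendsto (X ∘ φ) atTop (𝓝 X₀) ∧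
      IsSubMean P₀ X₀ Q₀ := by
  obtain ⟨X₀, φ, hφ, hX⟩ := exists_tendsto_subseq_of_fromBlocks (fun k => (h k).2) hP hQ
  refine ⟨X₀, φ, hφ, hX, ?_, ?_⟩
  · exact isClosed_setOf_posSemidef.mem_of_tendsto hX (.of_forall fun k => (h (φ k)).1)
  · have hc : Continuous fun t : Matrix n n ℂ × Matrix n n ℂ × Matrix n n ℂ =>
        fromBlocks t.1 t.2.1 t.2.1 t.2.2 := by fun_prop
    have := (hc.tendsto (P₀, X₀, Q₀)).comp
      ((hP.comp hφ.tendsto_atTop).prodMk_nhds (hX.prodMk_nhds (hQ.comp hφ.tendsto_atTop)))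
    exact isClosed_setOf_posSemidef.mem_of_tendsto this (.of_forall fun k => (h (φ k)).2)

/-- The traces of the operators below the geometric mean of `P` and `Q`. -/
def subMeanTraces (P Q : Matrix n n ℂ) : Set ℝ :=
  {t | ∃ X, IsSubMean P X Q ∧ t = X.trace.re}

theorem re_trace_le_of_fromBlocks {P X Q : Matrix n n ℂ} (h : (fromBlocks P X X Q).PosSemidef) :
    X.trace.re ≤ (P.trace.re + Q.trace.re) / 2 := by
  have := (Complex.nonneg_iff.mp (fromBlocks_compress_posSemidef h 1 (-1)).trace_nonneg).1
  simp at this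
  linarith

theorem subMeanTraces_bddAbove (P Q : Matrix n n ℂ) : BddAbove (subMeanTraces P Q) := by
  refine ⟨(P.trace.re + Q.trace.re) / 2, ?_⟩
  rintro _ ⟨X, hX, rfl⟩
  exact re_trace_le_of_fromBlocks hX.2

theorem isSubMean_zero {P Q : Matrix n n ℂ} (hP : P.PosSemidef) (hQ : Q.PosSemidef) :
    IsSubMean P 0 Q := by
  classical
  refine ⟨.zero, .of_dotProduct_mulVec_nonneg ?_ fun x => ?_⟩
  · simp [IsHermitian, fromBlocks_conjTranspose, hP.1.eq, hQ.1.eq]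
  · obtain ⟨u, v, rfl⟩ : ∃ u v, x = Sum.elim u v :=
      ⟨x ∘ Sum.inl, x ∘ Sum.inr, (Sum.elim_comp_inl_inr x).symm⟩
    have : star (Sum.elim u v) = Sum.elim (star u) (star v) := by
      ext (i | i) <;> simp
    simp only [fromBlocks_mulVec, Sum.elim_comp_inl, Sum.elim_comp_inr, this, sumElim_dotProduct_sumElim, zero_mulVec, zero_add,
      add_zero]
    exact add_nonneg (hP.dotProduct_mulVec_nonneg u) (hQ.dotProduct_mulVec_nonneg v)

theorem IsSubMean.congr {P X Q : Matrix n n ℂ} (h : IsSubMean P X Q) (K : Matrix m n ℂ) :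
    IsSubMean (K * P * Kᴴ) (K * X * Kᴴ) (K * Q * Kᴴ) :=
  ⟨h.1.mul_mul_conjTranspose_same K, fromBlocks_congr_posSemidef K h.2⟩

theorem IsSubMean.add_right {P X Q R : Matrix n n ℂ} (h : IsSubMean P X Q) (hR : R.PosSemidef) :
    IsSubMean P X (Q + R) := by
  refine ⟨h.1, ?_⟩
  have := h.2.add (isSubMean_zero .zero hR).2
  simpa [fromBlocks_add] using this

end PosSemidef

/-! ### The geometric mean trace as a maximum, and its limit for singular `Q`. -/

section GeometricMean

variable {n : Type*} [Fintype n] [DecidableEq n]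

/-- Operator monotonicity of the square root. If `D = S - X` had a unit eigenvector `v` with
eigenvalue `l < 0`, then `S² - X² = S D + D S - D²` would have expectation `2 l ⟨v, S v⟩ - l² < 0`
at `v`. -/
theorem posSemidef_sub_of_sq {S X : Matrix n n ℂ} (hS : S.PosSemidef) (hX : X.IsHermitian)
    (h : (S * S - X * X).PosSemidef) : (S - X).PosSemidef := by
  have hD : (S - X).IsHermitian := hS.1.sub hX
  rw [hD.posSemidef_iff_eigenvalues_nonneg]
  intro i
  by_contra hneg
  simp only [Pi.zero_apply, not_le] at hneg
  set l := hD.eigenvalues i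
  set v : n → ℂ := (hD.eigenvectorBasis i).ofLp
  have hv : (S - X) *ᵥ v = l • v := hD.mulVec_eigenvectorBasis i
  have hvv : star v ⬝ᵥ v = 1 := by
    have := hD.eigenvectorBasis.orthonormal.1 i
    rw [dotProduct_comm, ← EuclideanSpace.inner_eq_star_dotProduct]
    simp [inner_self_eq_norm_sq_to_K, this]
  have hleft : star v ᵥ* (S - X) = l • star v := by
    have := congrArg star hv
    rw [star_mulVec, hD.eq] at this
    simpa using this
  have hsq : S * S - X * X = S * (S - X) + (S - X) * S - (S - X) * (S - X) := by noncomm_ring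
  have h1 : star v ⬝ᵥ ((S * (S - X)) *ᵥ v) = l * (star v ⬝ᵥ (S *ᵥ v)) := by
    rw [← mulVec_mulVec, hv, mulVec_smul, dotProduct_smul, Complex.real_smul]
  have h2 : star v ⬝ᵥ (((S - X) * S) *ᵥ v) = l * (star v ⬝ᵥ (S *ᵥ v)) := by
    rw [← mulVec_mulVec, dotProduct_mulVec, hleft, smul_dotProduct, Complex.real_smul]
  have h3 : star v ⬝ᵥ (((S - X) * (S - X)) *ᵥ v) = l * l := by
    rw [← mulVec_mulVec, hv, mulVec_smul, hv, dotProduct_smul, dotProduct_smul, hvv]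
    simp
  have h4 := h.dotProduct_mulVec_nonneg v
  rw [hsq, sub_mulVec, add_mulVec, dotProduct_sub, dotProduct_add, h1, h2, h3] at h4
  have h5 := (Complex.nonneg_iff.mp (hS.dotProduct_mulVec_nonneg v)).1
  have h6 := (Complex.nonneg_iff.mp h4).1
  simp at h6
  nlinarith [mul_pos_of_neg_of_neg hneg hneg, mul_nonneg (neg_pos.mpr hneg).le h5]

theorem mpow_isHermitian (P : Matrix n n ℂ) (α : ℝ) : (mpow P α).IsHermitian :=
  cfc_predicate (R := ℝ) (p := IsSelfAdjoint) _ _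

theorem spectrum_nonneg_of_posSemidef {P : Matrix n n ℂ} (hP : P.PosSemidef) {x : ℝ}
    (hx : x ∈ spectrum ℝ P) : 0 ≤ x :=
  by simpa using (posSemidef_iff_isHermitian_and_spectrum_nonneg.mp hP).2 hx

theorem mpow_posSemidef {P : Matrix n n ℂ} (hP : P.PosSemidef) (α : ℝ) :
    (mpow P α).PosSemidef := by
  open scoped MatrixOrder in
  exact nonneg_iff_posSemidef.mp
    (cfc_nonneg fun x hx => Real.rpow_nonneg (spectrum_nonneg_of_posSemidef hP hx) α)

theorem continuousOn_spectrum (P : Matrix n n ℂ) (f : ℝ → ℝ) : ContinuousOn f (spectrum ℝ P) := 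
  (Matrix.finite_real_spectrum (A := P)).continuousOn f

theorem mpow_half_mul_self {P : Matrix n n ℂ} (hP : P.PosSemidef) :
    mpow P (1 / 2) * mpow P (1 / 2) = P := by
  have hsa : IsSelfAdjoint P := hP.1
  rw [mpow, ← cfc_mul _ _ P (continuousOn_spectrum _ _) (continuousOn_spectrum _ _)]
  conv_rhs => rw [← cfc_id ℝ P]
  refine cfc_congr fun x hx => ?_
  have := spectrum_nonneg_of_posSemidef hP hx
  rw [← Real.sqrt_eq_rpow, Real.mul_self_sqrt this, id]

theorem mpow_neg_half_mul_mul {P : Matrix n n ℂ} (hP : P.PosDef) :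
    mpow P (-(1 / 2)) * P * mpow P (-(1 / 2)) = 1 := by
  have hsa : IsSelfAdjoint P := hP.1
  have h0 : (0 : ℝ) ∉ spectrum ℝ P := spectrum.zero_notMem ℝ hP.isUnit
  have h : ∀ C : Matrix n n ℂ, C * P * C = C * cfc (id : ℝ → ℝ) P * C := fun C => by
    rw [cfc_id ℝ P]
  rw [h, mpow, ← cfc_mul _ _ P (continuousOn_spectrum _ _) (continuousOn_spectrum _ _),
    ← cfc_mul _ _ P (continuousOn_spectrum _ _) (continuousOn_spectrum _ _), ← cfc_one ℝ P]
  refine cfc_congr fun x hx => ?_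
  have hx0 := (spectrum_nonneg_of_posSemidef hP.posSemidef hx).lt_of_ne fun h => h0 (h ▸ hx)
  simp only [id, Pi.one_apply]
  rw [Real.rpow_neg hx0.le, ← Real.sqrt_eq_rpow]
  have := Real.sqrt_pos.mpr hx0
  field_simp
  rw [Real.sq_sqrt hx0.le]

theorem fromBlocks_one_posSemidef_iff {P X : Matrix n n ℂ} (hX : X.IsHermitian) :
    (fromBlocks P X X 1).PosSemidef ↔ (P - X * X).PosSemidef := by
  let _ : Invertible (1 : Matrix n n ℂ) := invertibleOne
  have := PosDef.fromBlocks₂₂ P X (PosDef.one : (1 : Matrix n n ℂ).PosDef)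
  rw [hX.eq] at this
  simpa using this

/-- The trace of the geometric mean of `P` and `Q`, for positive definite `Q`. -/
noncomputable def geometricMeanTrace (P Q : Matrix n n ℂ) : ℝ :=
  (Q * mpow (mpow Q (-(1 / 2)) * P * mpow Q (-(1 / 2))) (1 / 2)).trace.re

/-- The trace of the geometric mean is the largest trace of an operator below it. -/
theorem isGreatest_subMeanTraces {P Q : Matrix n n ℂ} (hP : P.PosSemidef) (hQ : Q.PosDef) :
    IsGreatest (subMeanTraces P Q) (geometricMeanTrace P Q) := by
  rw [geometricMeanTrace]
  set C := mpow Q (-(1 / 2)) with hC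
  have hCH : Cᴴ = C := mpow_isHermitian Q _
  have hCQ : C * Q * C = 1 := mpow_neg_half_mul_mul hQ
  have hPC : (C * P * C).PosSemidef := by
    simpa [hCH] using hP.mul_mul_conjTranspose_same C
  set S := mpow (C * P * C) (1 / 2) with hS
  have hSp : S.PosSemidef := mpow_posSemidef hPC _
  have hSS : S * S = C * P * C := mpow_half_mul_self hPC
  -- `K` plays the role of `Q ^ (1/2)`. Congruence by `C` normalises `Q` to the identity, where the
  -- Schur complement turns the block condition into `X² ≤ C P C`, so `S` is the largest solution;
  -- congruence by `K` returns.
  obtain ⟨K, hKC, hCK, hKK⟩ : ∃ K, K * C = 1 ∧ C * K = 1 ∧ K * K = Q := by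
    have h1 : (C * Q) * C = 1 := hCQ
    have h2 : C * (C * Q) = 1 := mul_eq_one_comm.mp h1
    refine ⟨C * Q, h1, h2, ?_⟩
    have h3 : (Q * C) * C = 1 := mul_eq_one_comm.mp (by rw [← Matrix.mul_assoc]; exact h1)
    calc C * Q * (C * Q) = C * Q * C * Q := by noncomm_ring
      _ = Q := by rw [h1, one_mul]
  have hKH : Kᴴ = K := by
    have := congrArg conjTranspose hKC
    rw [conjTranspose_mul, hCH, conjTranspose_one] at this
    calc Kᴴ = (K * C) * Kᴴ := by rw [hKC, one_mul]
      _ = K := by rw [Matrix.mul_assoc, this, mul_one]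
  have hQS : (Q * S).trace = (K * S * K).trace := by
    rw [← hKK, Matrix.mul_assoc, trace_mul_comm]
  have hcancel : ∀ T, K * (C * T * C) * K = T := fun T => by
    calc K * (C * T * C) * K = (K * C) * T * (C * K) := by noncomm_ring
      _ = T := by rw [hKC, hCK, one_mul, mul_one]
  constructor
  · refine ⟨K * S * K, ?_, by rw [hQS]⟩
    have h0 : IsSubMean (C * P * C) S 1 :=
      ⟨hSp, (fromBlocks_one_posSemidef_iff hSp.1).mpr (by rw [hSS, sub_self]; exact .zero)⟩
    have := h0.congr K
    rwa [hKH, hcancel, mul_one, hKK] at this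
  · rintro _ ⟨X, hX, rfl⟩
    have h1 := hX.congr C
    rw [hCH, hCQ] at h1
    have h2 := posSemidef_sub_of_sq hSp h1.1.1
      (by rw [hSS]; exact (fromBlocks_one_posSemidef_iff h1.1.1).mp h1.2)
    have h3 := (h2.mul_mul_conjTranspose_same K).trace_nonneg
    rw [hKH, mul_sub, sub_mul, hcancel, trace_sub, ← hQS] at h3
    have := (Complex.nonneg_iff.mp h3).1
    simpa using this

omit [Fintype n] in
theorem posDef_add_smul_one {Q : Matrix n n ℂ} (hQ : Q.PosSemidef) {ε : ℝ} (hε : 0 < ε) :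
    (Q + (ε : ℂ) • (1 : Matrix n n ℂ)).PosDef :=
  PosDef.posSemidef_add hQ (PosDef.one.smul (by simpa using hε))

omit [DecidableEq n] in
theorem zero_mem_subMeanTraces {P Q : Matrix n n ℂ} (hP : P.PosSemidef) (hQ : Q.PosSemidef) :
    0 ∈ subMeanTraces P Q := ⟨0, isSubMean_zero hP hQ, by simp⟩

theorem tendsto_trace_geometricMean {P Q : Matrix n n ℂ} (hP : P.PosSemidef)
    (hQ : Q.PosSemidef) :
    Tendsto (fun ε : ℝ => geometricMeanTrace P (Q + (ε : ℂ) • (1 : Matrix n n ℂ)))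
      (𝓝[>] (0 : ℝ)) (𝓝 (sSup (subMeanTraces P Q))) := by
  set g : ℝ → ℝ := fun ε => geometricMeanTrace P (Q + (ε : ℂ) • (1 : Matrix n n ℂ)) with hg
  have hmax : ∀ ε : ℝ, ε > 0 → IsGreatest (subMeanTraces P (Q + (ε : ℂ) • (1 : Matrix n n ℂ))) (g ε) :=
    fun ε hε => isGreatest_subMeanTraces hP (posDef_add_smul_one hQ hε)
  -- Enlarging `Q` keeps every witness, so the trace increases with `ε`; it therefore suffices to
  -- find one `δ` with value below `c`.
  have hmono : ∀ ε : ℝ, ε > 0 → ∀ δ > ε, g ε ≤ g δ := fun ε hε δ hδ => by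
    obtain ⟨X, hX, hXt⟩ := (hmax ε hε).1
    have := hX.add_right (R := ((δ - ε : ℝ) : ℂ) • (1 : Matrix n n ℂ))
      (PosSemidef.one.smul (by simpa using hδ.le))
    rw [add_assoc, ← add_smul] at this
    exact (hmax δ (hε.trans hδ)).2 ⟨X, by simpa using this, hXt⟩
  refine tendsto_order.mpr ⟨fun c hc => ?_, fun c hc => ?_⟩
  · filter_upwards [self_mem_nhdsWithin] with ε hε
    refine hc.trans_le (csSup_le ⟨0, zero_mem_subMeanTraces hP hQ⟩ ?_)
    rintro _ ⟨X, hX, rfl⟩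
    exact (hmax ε hε).2 ⟨X, hX.add_right (PosSemidef.one.smul (by simpa using le_of_lt hε)), rfl⟩
  · obtain ⟨δ, hδ, hgδ⟩ : ∃ δ > 0, g δ < c := by
      -- Otherwise the optimal witnesses for `ε = 1 / (k + 1)` have traces at least `c`, and a limit
      -- point of them is a witness for `Q` itself with trace at least `c`, above the supremum.
      by_contra! hcon
      have hpos : ∀ k : ℕ, (0 : ℝ) < 1 / ((k : ℝ) + 1) := fun k => by positivity
      choose X hX hXt using fun k : ℕ => (hmax _ (hpos k)).1
      have hQlim : Tendsto (fun k : ℕ => Q + ((1 / ((k : ℝ) + 1) : ℝ) : ℂ) • (1 : Matrix n n ℂ))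
          atTop (𝓝 Q) := by
        have h1 : Continuous fun e : ℝ => Q + (e : ℂ) • (1 : Matrix n n ℂ) := by fun_prop
        have h2 := (h1.tendsto 0).comp (tendsto_one_div_add_atTop_nhds_zero_nat (𝕜 := ℝ))
        rwa [Complex.ofReal_zero, zero_smul, add_zero] at h2
      obtain ⟨X₀, φ, hφ, hlim, hX₀⟩ := exists_isSubMean_of_tendsto hX tendsto_const_nhds hQlim
      have htr : Continuous fun T : Matrix n n ℂ => T.trace.re := by fun_prop
      have hge : c ≤ X₀.trace.re := ge_of_tendsto ((htr.tendsto X₀).comp hlim)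
        (.of_forall fun k => (hcon _ (hpos (φ k))).trans (hXt (φ k)).le)
      exact absurd (le_csSup (subMeanTraces_bddAbove P Q) ⟨X₀, hX₀, rfl⟩) (by linarith)
    filter_upwards [Ioo_mem_nhdsGT hδ] with ε hε
    exact (hmono ε hε.1 δ hε.2).trans_lt hgδ

theorem geometricQuasi_half {P Q : Matrix n n ℂ} (hP : P.PosSemidef) (hQ : Q.PosSemidef) :
    geometricQuasi (1 / 2) P Q = ENNReal.ofReal (sSup (subMeanTraces P Q)) :=
  ((ENNReal.continuous_ofReal.tendsto _).comp (tendsto_trace_geometricMean hP hQ)).limUnder_eq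

end GeometricMean

/-! ### Action of a map through its Choi operator. -/

section Contract

variable {R A B U : Type*}

/-- The map on the `A`-system with Choi operator `T`, applied to an operator on `R ⊗ A`. -/
def contract [Fintype A] (T : Matrix (A × B) (A × B) ℂ) (X : Matrix (R × A) (R × A) ℂ) :
    Matrix (R × B) (R × B) ℂ :=
  Matrix.of fun i j => ∑ a, ∑ a', X (i.1, a) (j.1, a') * T (a, i.2) (a', j.2)

theorem choi_apply [DecidableEq A] (Φ : Matrix A A ℂ →ₗ[ℂ] Matrix B B ℂ) (a a' : A) (b b' : B) :
    choi Φ (a, b) (a', b') = Φ (Matrix.single a a' 1) b b' := by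
  simp only [choi, ampl, of_apply]
  congr 2

theorem ampl_eq_contract [Fintype A] [DecidableEq A] (Φ : Matrix A A ℂ →ₗ[ℂ] Matrix B B ℂ)
    (X : Matrix (R × A) (R × A) ℂ) : ampl R Φ X = contract (choi Φ) X := by
  ext i j
  have h : ∀ Y : Matrix A A ℂ, Φ Y = ∑ a, ∑ a', Y a a' • Φ (Matrix.single a a' 1) := fun Y => by
    conv_lhs => rw [matrix_eq_sum_single Y]
    simp only [map_sum, ← map_smul, smul_single, smul_eq_mul, mul_one]
  simp only [ampl, contract, of_apply]
  rw [h]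
  simp [Matrix.sum_apply, choi_apply]

/-- The summed matrix is the congruence by the 0/1 matrix of the projection `U × A → U`. Contraction
with a Choi operator has this form: it sums the principal submatrix of `X ⊗ T` on which the two
`A`-indices agree. -/
theorem sum_entries_posSemidef [Fintype U] [Fintype A] {M : Matrix (U × A) (U × A) ℂ}
    (hM : M.PosSemidef) :
    (Matrix.of fun u u' => ∑ a, ∑ a', M (u, a) (u', a') : Matrix U U ℂ).PosSemidef := by
  classical
  have := hM.mul_mul_conjTranspose_same
    (Matrix.of fun u p => if u = p.1 then 1 else 0 : Matrix U (U × A) ℂ)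
  convert this using 1
  ext u u'
  have h : ∀ a', ∑ x, (∑ a, M (u, a) (x, a')) * (if u' = x then 1 else 0)
      = ∑ a, M (u, a) (u', a') := fun a' => by simp
  have h' : ∀ y, ∑ x, ∑ a, (if u = x then 1 else 0) * M (x, a) y = ∑ a, M (u, a) y :=
    fun y => by rw [Finset.sum_comm]; simp
  simp only [mul_apply, of_apply, conjTranspose_apply, Fintype.sum_prod_type, apply_ite star,
    star_one, star_zero, h']
  rw [Finset.sum_comm, Finset.sum_comm (s := Finset.univ (α := U))]
  exact Finset.sum_congr rfl fun a' _ => (h a').symm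

theorem kronecker_posSemidef {m n : Type*} [Fintype m] [Fintype n] {P : Matrix m m ℂ}
    {Q : Matrix n n ℂ} (hP : P.PosSemidef) (hQ : Q.PosSemidef) : (P ⊗ₖ Q).PosSemidef :=
  PosSemidef.kronecker hP hQ

theorem contract_posSemidef [Fintype R] [Fintype A] [Fintype B] {T : Matrix (A × B) (A × B) ℂ}
    {X : Matrix (R × A) (R × A) ℂ} (hT : T.PosSemidef) (hX : X.PosSemidef) :
    (contract T X).PosSemidef := by
  have := sum_entries_posSemidef ((kronecker_posSemidef hX hT).submatrix
    fun p : (R × B) × A => ((p.1.1, p.2), (p.2, p.1.2)))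
  exact this

/-- Choi operators below a geometric mean map operators below a geometric mean to such operators. -/
theorem IsSubMean.contract [Fintype R] [Fintype A] [Fintype B]
    {C₁ T C₂ : Matrix (A × B) (A × B) ℂ} {P X Q : Matrix (R × A) (R × A) ℂ}
    (hT : IsSubMean C₁ T C₂) (hX : IsSubMean P X Q) :
    IsSubMean (contract C₁ P) (contract T X) (contract C₂ Q) := by
  refine ⟨contract_posSemidef hT.1 hX.1, ?_⟩
  have := sum_entries_posSemidef ((kronecker_posSemidef hX.2 hT.2).submatrix
    fun p : ((R × B) ⊕ (R × B)) × A =>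
      (Sum.map (fun i => (i.1, p.2)) (fun i => (i.1, p.2)) p.1,
        Sum.map (fun i => (p.2, i.2)) (fun i => (p.2, i.2)) p.1))
  convert this using 1
  ext (i | i) (j | j) <;> rfl

/-- The trace of the contraction is `Tr[X_A (Tr_B T)ᵀ]`, with `X_A` the reduced operator of `X` on
`A`; transposition preserves `Tr_B T ≥ μ`. -/
theorem trace_contract_ge [Fintype R] [Fintype A] [DecidableEq A] [Fintype B]
    {T : Matrix (A × B) (A × B) ℂ} {X : Matrix (R × A) (R × A) ℂ} {μ : ℝ}
    (hT : (partialTraceRight T - (μ : ℂ) • (1 : Matrix A A ℂ)).PosSemidef) (hX : X.PosSemidef) :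
    μ * X.trace.re ≤ (contract T X).trace.re := by
  have hred : (∑ r : R, X.submatrix (Prod.mk r) (Prod.mk r)).PosSemidef :=
    posSemidef_sum _ fun r _ => hX.submatrix _
  have h1 : ((∑ r : R, X.submatrix (Prod.mk r) (Prod.mk r)) * (partialTraceRight T)ᵀ).trace
      = (ChannelDiscrimination.contract T X).trace := by
    simp only [Matrix.trace, diag_apply, mul_apply, Matrix.sum_apply, submatrix_apply,
      transpose_apply, partialTraceRight, ChannelDiscrimination.contract, of_apply,
      Fintype.sum_prod_type, Finset.sum_mul, Finset.mul_sum]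
    calc _ = ∑ a, ∑ r, ∑ a', ∑ b, X (r, a) (r, a') * T (a, b) (a', b) := by
          refine Finset.sum_congr rfl fun a _ => ?_
          rw [Finset.sum_comm]
      _ = ∑ r, ∑ a, ∑ b, ∑ a', X (r, a) (r, a') * T (a, b) (a', b) := by
          rw [Finset.sum_comm]
          exact Finset.sum_congr rfl fun r _ => Finset.sum_congr rfl fun a _ => Finset.sum_comm
      _ = _ := Finset.sum_congr rfl fun r _ => Finset.sum_comm
  have h2 : (∑ r : R, X.submatrix (Prod.mk r) (Prod.mk r)).trace = X.trace := by
    simp only [Matrix.trace, diag_apply, Matrix.sum_apply, submatrix_apply,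
      Fintype.sum_prod_type]
    exact Finset.sum_comm
  have := re_trace_mul_nonneg hred hT.transpose
  rw [transpose_sub, mul_sub, trace_sub, h1, transpose_smul, transpose_one, Matrix.mul_smul, mul_one,
    trace_smul, h2] at this
  simpa using this

theorem trace_ampl [Fintype R] [Fintype A] [Fintype B] {Φ : Matrix A A ℂ →ₗ[ℂ] Matrix B B ℂ}
    (hΦ : ∀ X, (Φ X).trace = X.trace) (X : Matrix (R × A) (R × A) ℂ) :
    (ampl R Φ X).trace = X.trace := by
  simp only [Matrix.trace, diag_apply, ampl, of_apply, Fintype.sum_prod_type]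
  refine Finset.sum_congr rfl fun r _ => ?_
  exact hΦ (Matrix.of fun a a' => X (r, a) (r, a'))

theorem IsCompletelyPositive.posSemidef [Fintype A] [Fintype B]
    {Φ : Matrix A A ℂ →ₗ[ℂ] Matrix B B ℂ}
    (hΦ : IsCompletelyPositive Φ) {X : Matrix A A ℂ} (hX : X.PosSemidef) : (Φ X).PosSemidef :=
  (hΦ 1 _ (hX.submatrix Prod.snd)).submatrix (Prod.mk 0)

/-- A 2 × 2 block matrix is an operator on `ℂ² ⊗ A`, and `id ⊗ Φ` acts on it blockwise, so
2-positivity is enough. -/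
theorem IsCompletelyPositive.isSubMean [Fintype A] [Fintype B]
    {Φ : Matrix A A ℂ →ₗ[ℂ] Matrix B B ℂ}
    (hΦ : IsCompletelyPositive Φ) {P X Q : Matrix A A ℂ} (h : IsSubMean P X Q) :
    IsSubMean (Φ P) (Φ X) (Φ Q) := by
  refine ⟨hΦ.posSemidef h.1, ?_⟩
  have := (hΦ 2 _ (h.2.submatrix
    fun p : Fin 2 × A => if p.1 = 0 then Sum.inl p.2 else Sum.inr p.2)).submatrix
      (Sum.elim (fun b => ((0 : Fin 2), b)) fun b => ((1 : Fin 2), b))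
  convert this using 1
  ext (i | i) (j | j) <;> rfl

theorem choi_posSemidef [Fintype A] [DecidableEq A] [Fintype B]
    {Φ : Matrix A A ℂ →ₗ[ℂ] Matrix B B ℂ} (hΦ : IsCompletelyPositive Φ) :
    (choi Φ).PosSemidef := by
  have h1 : (maxEntangled A).PosSemidef := by
    convert posSemidef_vecMulVec_self_star (fun p : A × A => if p.1 = p.2 then (1 : ℂ) else 0)
      using 1
    ext i j
    by_cases h : i.1 = i.2 <;> by_cases h' : j.1 = j.2 <;>
      simp [maxEntangled, vecMulVec_apply, h, h']
  -- Complete positivity is stated for reference systems `Fin d`, so the copy of `A` is relabelled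
  -- and then restored.
  have e := Fintype.equivFin A
  exact (hΦ _ _ (h1.submatrix (Prod.map e.symm id))).submatrix (Prod.map e id) |> fun h => by
    convert h using 1
    ext i j
    simp [choi, ampl]

theorem trace_choi [Fintype A] [DecidableEq A] [Fintype B]
    {Φ : Matrix A A ℂ →ₗ[ℂ] Matrix B B ℂ} (hΦ : ∀ X, (Φ X).trace = X.trace) :
    (choi Φ).trace = Fintype.card A := by
  rw [choi, trace_ampl hΦ]
  simp [maxEntangled, Matrix.trace, Fintype.sum_prod_type, -Finset.sum_boole]

end Contract

/-! ### Witnesses along a sequential strategy and the error lower bound. -/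

section Sequential

variable {A B : Type*} [Fintype A] [DecidableEq A] [Fintype B]

/-- Both hypotheses share the input state, so the input is its own witness, of trace one; this
starts the induction over calls. -/
theorem isSubMean_self {n : Type*} [Fintype n] {P : Matrix n n ℂ} (hP : P.PosSemidef) :
    IsSubMean P P P := by
  classical
  refine ⟨hP, ?_⟩
  have := hP.mul_mul_conjTranspose_same (fromRows (1 : Matrix n n ℂ) (1 : Matrix n n ℂ))
  rwa [conjTranspose_fromRows_eq_fromCols_conjTranspose, fromRows_mul,
    fromRows_mul_fromCols, conjTranspose_one, one_mul, mul_one] at this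

omit [Fintype A] in
theorem mem_primalValues_iff {N M : Matrix A A ℂ →ₗ[ℂ] Matrix B B ℂ} {μ : ℝ} :
    μ ∈ primalValues N M ↔ 0 ≤ μ ∧ ∃ X, IsSubMean (choi N) X (choi M) ∧
      (partialTraceRight X - (μ : ℂ) • (1 : Matrix A A ℂ)).PosSemidef := by
  simp only [primalValues, IsSubMean, Set.mem_ofPred_eq, and_assoc]

/-- A single call multiplies the trace of an operator below the geometric mean of the two states
by at least a feasible value of the primal program. -/
theorem exists_isSubMean_ampl {R : Type*} [Fintype R] {N M : Matrix A A ℂ →ₗ[ℂ] Matrix B B ℂ}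
    {μ : ℝ} (hμ : μ ∈ primalValues N M) {P X Q : Matrix (R × A) (R × A) ℂ}
    (h : IsSubMean P X Q) :
    ∃ X', IsSubMean (ampl R N P) X' (ampl R M Q) ∧ μ * X.trace.re ≤ X'.trace.re := by
  obtain ⟨-, T, hT, hμT⟩ := mem_primalValues_iff.mp hμ
  rw [ampl_eq_contract, ampl_eq_contract]
  exact ⟨_, hT.contract h, trace_contract_ge hμT h.1⟩

/-- Each call contributes a factor `μ` and each interleaved channel none. The index `k` stands for
`k + 1` calls, hence the exponent. -/
theorem Strategy.exists_isSubMean_stateAfter {N M : Matrix A A ℂ →ₗ[ℂ] Matrix B B ℂ}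
    {n : ℕ} (S : Strategy A B n) {μ : ℝ} (hμ : μ ∈ primalValues N M) (k : ℕ) (hk : k < n) :
    ∃ X, IsSubMean (S.stateAfter N k) X (S.stateAfter M k) ∧ μ ^ (k + 1) ≤ X.trace.re := by
  have hμ0 := hμ.1
  induction k with
  | zero =>
    obtain ⟨X, hX, hXt⟩ := exists_isSubMean_ampl hμ (isSubMean_self S.input_isState.1)
    exact ⟨X, hX, by simpa [S.input_isState.2] using hXt⟩
  | succ k ih =>
    obtain ⟨X, hX, hXt⟩ := ih (by omega)
    have hS := S.interleave_isChannel k hk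
    obtain ⟨X', hX', hXt'⟩ := exists_isSubMean_ampl hμ (hS.1.isSubMean hX)
    refine ⟨X', hX', ?_⟩
    rw [hS.2] at hXt'
    rw [pow_succ']
    exact (mul_le_mul_of_nonneg_left hXt hμ0).trans hXt'

omit [DecidableEq A] in
theorem Strategy.trace_stateAfter {Φ : Matrix A A ℂ →ₗ[ℂ] Matrix B B ℂ}
    (hΦ : ∀ X, (Φ X).trace = X.trace) {n : ℕ} (S : Strategy A B n) (k : ℕ) (hk : k < n) :
    (S.stateAfter Φ k).trace = 1 := by
  induction k with
  | zero => exact (trace_ampl hΦ _).trans S.input_isState.2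
  | succ k ih =>
    exact ((trace_ampl hΦ _).trans ((S.interleave_isChannel k hk).2 _)).trans (ih (by omega))

/-- The error of discriminating two states is bounded below by the trace of any operator below
their geometric mean. -/
theorem error_ge_of_isSubMean {n : Type*} [Fintype n] [DecidableEq n] {P X Q T : Matrix n n ℂ}
    (h : IsSubMean P X Q) (hP : P.trace = 1) (hQ : Q.trace = 1) (hT : IsTest T) {p : ℝ}
    (hp0 : 0 < p) (hp1 : p < 1) :
    p * (1 - p) * X.trace.re ^ 2 ≤
      p * ((1 - T) * P).trace.re + (1 - p) * (T * Q).trace.re := by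
  have hPp := posSemidef_of_fromBlocks₁₁ h.2
  have hQp := posSemidef_of_fromBlocks₂₂ h.2
  have h1 := sq_re_trace_mul_le h.2 hT.1
  have h2 := sq_re_trace_mul_le h.2 hT.2
  have a1 := re_trace_mul_nonneg hT.1 hPp
  have a2 := re_trace_mul_nonneg hT.1 hQp
  have a3 := re_trace_mul_nonneg hT.2 hPp
  have a4 := re_trace_mul_nonneg hT.2 hQp
  have e : ∀ Y : Matrix n n ℂ, ((1 - T) * Y).trace.re = Y.trace.re - (T * Y).trace.re :=
    fun Y => by rw [sub_mul, one_mul, trace_sub, Complex.sub_re]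
  simp only [e, hP, hQ, Complex.one_re] at *
  set x := (T * X).trace.re
  set a := (T * P).trace.re
  set b := (T * Q).trace.re
  set g := X.trace.re
  -- Cauchy-Schwarz for both outcomes, with the factors `a` and `1 - b` bounded by one. What remains
  -- is `p (g - x)² + (1 - p) x² ≥ p (1 - p) g²`, whose defect is the square `(p g - x)²`.
  have h1' : x ^ 2 ≤ b := h1.trans (mul_le_of_le_one_left a2 (by linarith))
  have h2' : (g - x) ^ 2 ≤ 1 - a := h2.trans (mul_le_of_le_one_right a3 (by linarith))
  have i1 := mul_le_mul_of_nonneg_left h1' (sub_nonneg.mpr hp1.le)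
  have i2 := mul_le_mul_of_nonneg_left h2' hp0.le
  have i3 := sq_nonneg (p * (g - x) - (1 - p) * x)
  linarith

theorem errorProb_ge [DecidableEq B] {N M : Matrix A A ℂ →ₗ[ℂ] Matrix B B ℂ} (hN : IsChannel N)
    (hM : IsChannel M) {n : ℕ} (hn : 1 ≤ n) {p : ℝ} (hp0 : 0 < p) (hp1 : p < 1) {μ : ℝ}
    (hμ : μ ∈ primalValues N M) (S : Strategy A B n)
    {T : Matrix (Fin (S.mem (n - 1)) × B) (Fin (S.mem (n - 1)) × B) ℂ} (hT : IsTest T) :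
    p * (1 - p) * (μ ^ n) ^ 2 ≤ errorProb p N M S T := by
  obtain ⟨X, hX, hXt⟩ := S.exists_isSubMean_stateAfter hμ (n - 1) (by omega)
  rw [Nat.sub_add_cancel hn] at hXt
  refine le_trans ?_ (error_ge_of_isSubMean hX (S.trace_stateAfter hN.2 _ (by omega))
    (S.trace_stateAfter hM.2 _ (by omega)) hT hp0 hp1)
  have := pow_nonneg hμ.1 n
  have := mul_pos hp0 (sub_pos.mpr hp1)
  gcongr

/-- The real infimum of an empty set is `0`, so lower bounds on the optimal error need some
strategy: discard everything and prepare a fixed basis state. -/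
theorem exists_strategy [DecidableEq B] [Nonempty A] (n : ℕ) : Nonempty (Strategy A B n) := by
  have a₀ : A := Classical.arbitrary A
  let E : Matrix (Fin 1 × A) (Fin 1 × A) ℂ := Matrix.single (0, a₀) (0, a₀) 1
  have hE : IsState E := by
    refine ⟨?_, by simp [E]⟩
    have : E = vecMulVec (Pi.single (0, a₀) 1) (star (Pi.single (0, a₀) (1 : ℂ))) := by
      ext i j
      by_cases h : i = (0, a₀) <;> by_cases h' : j = (0, a₀) <;>
        simp [E, vecMulVec_apply, h, h', eq_comm]
    rw [this]
    exact posSemidef_vecMulVec_self_star _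
  let Φ : Matrix (Fin 1 × B) (Fin 1 × B) ℂ →ₗ[ℂ] Matrix (Fin 1 × A) (Fin 1 × A) ℂ :=
    (Matrix.traceLinearMap _ ℂ ℂ).smulRight E
  refine ⟨⟨fun _ => 1, E, hE, fun _ => Φ, fun i _ => ⟨fun d X hX => ?_, fun X => ?_⟩⟩⟩
  · have h1 : (∑ q : Fin 1 × B, X.submatrix (fun r => (r, q)) (fun r => (r, q))).PosSemidef :=
      posSemidef_sum _ fun q _ => hX.submatrix _
    have h2 := kronecker_posSemidef h1 hE.1
    convert h2 using 1
    ext i j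
    simp [ampl, Φ, Matrix.trace, kroneckerMap_apply, Matrix.sum_apply]
  · simp [Φ, hE.2]

end Sequential

/-! ### Positive functionals on matrices. -/

section Functionals

variable {m n : Type*} [Fintype n]

omit [Fintype n] in
theorem real_smul_posSemidef {P : Matrix n n ℂ} (hP : P.PosSemidef) {t : ℝ} (ht : 0 ≤ t) :
    (t • P).PosSemidef := by
  have := hP.smul (a := (t : ℂ)) (by simpa using ht)
  rwa [Complex.coe_smul] at this

/-- A real-linear functional that is nonnegative on positive matrices is, on Hermitian matrices,
the pairing with a positive matrix. -/
theorem exists_posSemidef_eq_trace (f : Matrix n n ℂ →ₗ[ℝ] ℝ)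
    (hf : ∀ P : Matrix n n ℂ, P.PosSemidef → 0 ≤ f P) :
    ∃ H : Matrix n n ℂ, H.PosSemidef ∧ ∀ X : Matrix n n ℂ, X.IsHermitian →
      f X = (H * X).trace.re := by
  classical
  -- `G` represents `f` as `Re Tr[G X]` on the real basis `E_ij`, `i E_ij`. Only its Hermitian part
  -- matters on Hermitian `X`, and rank-one `X` test its positivity.
  let G : Matrix n n ℂ := Matrix.of fun j i =>
    (f (Matrix.single i j 1) : ℂ) - (f (Matrix.single i j Complex.I) : ℂ) * Complex.I
  have hG : ∀ X, f X = (G * X).trace.re := fun X => by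
    have h1 : ∀ i j, f (Matrix.single i j (X i j)) = (G j i * X i j).re := fun i j => by
      have : Matrix.single i j (X i j) =
          (X i j).re • Matrix.single i j (1 : ℂ) + (X i j).im • Matrix.single i j Complex.I := by
        rw [smul_single, smul_single, ← single_add]
        congr 1
        simp [Complex.re_add_im]
      rw [this, map_add, map_smul, map_smul]
      simp [G, mul_comm]
    conv_lhs => rw [matrix_eq_sum_single X]
    simp only [map_sum, h1]
    simp only [Matrix.trace, diag_apply, mul_apply, Complex.re_sum]
    exact Finset.sum_comm
  have hGH : ∀ X : Matrix n n ℂ, X.IsHermitian → (Gᴴ * X).trace.re = (G * X).trace.re :=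
    fun X hX => by
      have : Gᴴ * X = (X * G)ᴴ := by rw [conjTranspose_mul, hX.eq]
      rw [this, trace_conjTranspose, trace_mul_comm]
      simp
  have hH : ∀ X : Matrix n n ℂ, X.IsHermitian →
      f X = (((1 / 2 : ℂ) • (G + Gᴴ)) * X).trace.re := fun X hX => by
    rw [smul_mul, trace_smul, add_mul, trace_add, smul_eq_mul, mul_add, Complex.add_re]
    have := hGH X hX
    have := hG X
    simp
    linarith
  have hHerm : ((1 / 2 : ℂ) • (G + Gᴴ)).IsHermitian := by
    simp [IsHermitian, conjTranspose_smul, add_comm]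
  refine ⟨_, .of_dotProduct_mulVec_nonneg hHerm fun v => ?_, hH⟩
  have h1 : star v ⬝ᵥ (((1 / 2 : ℂ) • (G + Gᴴ)) *ᵥ v)
      = (((1 / 2 : ℂ) • (G + Gᴴ)) * vecMulVec v (star v)).trace := by
    rw [mul_vecMulVec, trace_vecMulVec, dotProduct_comm]
  rw [Complex.nonneg_iff]
  constructor
  · rw [h1, ← hH _ (posSemidef_vecMulVec_self_star v).1]
    exact hf _ (posSemidef_vecMulVec_self_star v)
  · exact (hHerm.im_star_dotProduct_mulVec_self v).symm

theorem trace_fromBlocks (P X Y Q : Matrix n n ℂ) :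
    (fromBlocks P X Y Q).trace = P.trace + Q.trace := by
  simp [Matrix.trace, Fintype.sum_sum_type]

/-- If `a < 0`, the chosen `t` makes `c - t * a` equal to `u`. This yields the sign of each
multiplier along a ray of its cone. -/
theorem nonneg_of_forall_sub_mul_lt {a c u : ℝ} (h : ∀ t : ℝ, 0 ≤ t → c - t * a < u) : 0 ≤ a := by
  by_contra! ha
  have h0 := h 0 le_rfl
  have := h ((u - c) / (-a)) (div_nonneg (by linarith) (by linarith))
  have e : (u - c) / (-a) * a = -(u - c) := by
    rw [div_neg, neg_mul, div_mul_cancel₀ _ ha.ne]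
  rw [e] at this
  linarith

end Functionals

/-! ### Strong duality by separation. -/

section Duality

variable {A B : Type*} [Fintype A] [DecidableEq A] [Fintype B] [DecidableEq B]

omit [DecidableEq A] in
theorem trace_kronecker_one_mul (ρ : Matrix A A ℂ) (X : Matrix (A × B) (A × B) ℂ) :
    ((ρ ⊗ₖ (1 : Matrix B B ℂ)) * X).trace = (ρ * partialTraceRight X).trace := by
  simp only [Matrix.trace, diag_apply, mul_apply, Fintype.sum_prod_type, kroneckerMap_apply,
    one_apply, mul_ite, mul_one, mul_zero, ite_mul, zero_mul, Finset.sum_ite_eq, Finset.mem_univ,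
    if_true, partialTraceRight, of_apply, Finset.mul_sum]
  exact Finset.sum_congr rfl fun a _ => Finset.sum_comm

omit [Fintype A] [DecidableEq A] [DecidableEq B] in
theorem partialTraceRight_isHermitian {X : Matrix (A × B) (A × B) ℂ} (hX : X.IsHermitian) :
    (partialTraceRight X).IsHermitian := by
  ext a a'
  simp only [conjTranspose_apply, partialTraceRight, of_apply, star_sum]
  exact Finset.sum_congr rfl fun b _ => hX.apply _ _

omit [Fintype A] [DecidableEq A] [DecidableEq B] in
theorem partialTraceRight_add (X Y : Matrix (A × B) (A × B) ℂ) :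
    partialTraceRight (X + Y) = partialTraceRight X + partialTraceRight Y := by
  ext
  simp [partialTraceRight, Finset.sum_add_distrib]

omit [Fintype A] [DecidableEq A] [DecidableEq B] in
theorem partialTraceRight_smul (t : ℝ) (X : Matrix (A × B) (A × B) ℂ) :
    partialTraceRight (t • X) = t • partialTraceRight X := by
  ext
  simp [partialTraceRight, Finset.mul_sum]

omit [Fintype A] [DecidableEq A] [DecidableEq B] in
theorem continuous_partialTraceRight :
    Continuous (partialTraceRight : Matrix (A × B) (A × B) ℂ → Matrix A A ℂ) :=
  continuous_matrix fun a a' => by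
    simp only [partialTraceRight, of_apply]
    fun_prop

instance instFirstCountableTopologyMatrix {m n : Type*} [Fintype m] [Fintype n] :
    FirstCountableTopology (Matrix m n ℂ) :=
  inferInstanceAs (FirstCountableTopology (m → n → ℂ))

instance instLocallyConvexSpaceMatrix {m n : Type*} : LocallyConvexSpace ℝ (Matrix m n ℂ) :=
  inferInstanceAs (LocallyConvexSpace ℝ (m → n → ℂ))

/-- The slacks of the constraints of the primal program with objective value `μ`, minus arbitrary
positive operators. The program is feasible exactly if this set contains zero. -/
def primalSlacks (P Q : Matrix (A × B) (A × B) ℂ) (μ : ℝ) :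
    Set (Matrix (A × B) (A × B) ℂ × Matrix A A ℂ ×
      Matrix ((A × B) ⊕ (A × B)) ((A × B) ⊕ (A × B)) ℂ) :=
  {d | ∃ X : Matrix (A × B) (A × B) ℂ, X.IsHermitian ∧ (X - d.1).PosSemidef ∧
    (partialTraceRight X - μ • 1 - d.2.1).PosSemidef ∧
    (fromBlocks P X X Q - d.2.2).PosSemidef}

omit [Fintype A] [DecidableEq B] in
theorem convex_primalSlacks (P Q : Matrix (A × B) (A × B) ℂ) (μ : ℝ) :
    Convex ℝ (primalSlacks P Q μ) := by
  rintro d ⟨X, hX, h1, h2, h3⟩ d' ⟨X', hX', h1', h2', h3'⟩ a b ha hb hab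
  refine ⟨a • X + b • X', ?_, ?_, ?_, ?_⟩
  · simp [IsHermitian, conjTranspose_smul, hX.eq, hX'.eq]
  · convert (real_smul_posSemidef h1 ha).add (real_smul_posSemidef h1' hb) using 1
    simp only [Prod.fst_add, Prod.smul_fst]
    module
  · convert (real_smul_posSemidef h2 ha).add (real_smul_posSemidef h2' hb) using 1
    obtain rfl : b = 1 - a := by linarith
    simp only [Prod.fst_add, Prod.smul_fst, Prod.snd_add, Prod.smul_snd,
      partialTraceRight_add, partialTraceRight_smul]
    module
  · convert (real_smul_posSemidef h3 ha).add (real_smul_posSemidef h3' hb) using 1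
    have : fromBlocks P (a • X + b • X') (a • X + b • X') Q
        = a • fromBlocks P X X Q + b • fromBlocks P X' X' Q := by
      rw [fromBlocks_smul, fromBlocks_smul, fromBlocks_add, ← add_smul, ← add_smul, hab, one_smul,
        one_smul]
    simp only [Prod.snd_add, Prod.smul_snd, this]
    module

omit [DecidableEq B] in
-- Along a convergent sequence of slacks the diagonal blocks converge, so the block constraint
-- bounds the shifted corners and the operators `X k` subconverge. This closedness replaces a strict
-- feasibility assumption.
theorem isClosed_primalSlacks (P Q : Matrix (A × B) (A × B) ℂ) (μ : ℝ) :
    IsClosed (primalSlacks P Q μ) := by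
  refine IsSeqClosed.isClosed fun d d₀ hd hlim => ?_
  choose X hX h1 h2 h3 using hd
  have l1 := (continuous_fst.tendsto d₀).comp hlim
  have l2 := ((continuous_fst.comp continuous_snd).tendsto d₀).comp hlim
  have l3 := ((continuous_snd.comp continuous_snd).tendsto d₀).comp hlim
  have c11 : Continuous fun T : Matrix ((A × B) ⊕ (A × B)) ((A × B) ⊕ (A × B)) ℂ =>
      P - T.toBlocks₁₁ := continuous_const.sub (continuous_id.matrix_submatrix Sum.inl Sum.inl)
  have c22 : Continuous fun T : Matrix ((A × B) ⊕ (A × B)) ((A × B) ⊕ (A × B)) ℂ =>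
      Q - T.toBlocks₂₂ := continuous_const.sub (continuous_id.matrix_submatrix Sum.inr Sum.inr)
  have c12 : Continuous fun T : Matrix ((A × B) ⊕ (A × B)) ((A × B) ⊕ (A × B)) ℂ =>
      T.toBlocks₁₂ := continuous_id.matrix_submatrix Sum.inl Sum.inr
  obtain ⟨X₀, φ, hφ, hX₀⟩ := exists_tendsto_subseq_of_fromBlocks
    (P := fun k => P - (d k).2.2.toBlocks₁₁) (X := fun k => X k - (d k).2.2.toBlocks₁₂)
    (Y := fun k => X k - (d k).2.2.toBlocks₂₁) (Q := fun k => Q - (d k).2.2.toBlocks₂₂)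
    (fun k => by
      convert h3 k using 1
      ext (i | i) (j | j) <;> rfl)
    ((c11.tendsto _).comp l3) ((c22.tendsto _).comp l3)
  have hXlim : Tendsto (X ∘ φ) atTop (𝓝 (X₀ + d₀.2.2.toBlocks₁₂)) := by
    have := hX₀.add (((c12.tendsto _).comp l3).comp hφ.tendsto_atTop)
    refine this.congr fun k => ?_
    simp
  set X' := X₀ + d₀.2.2.toBlocks₁₂
  have hblock : Continuous fun T : Matrix (A × B) (A × B) ℂ => fromBlocks P T T Q := by fun_prop
  refine ⟨X', ?_, ?_, ?_, ?_⟩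
  · have hc : IsClosed {T : Matrix (A × B) (A × B) ℂ | Tᴴ = T} :=
      isClosed_eq (by fun_prop) continuous_id
    exact hc.mem_of_tendsto hXlim (.of_forall fun k => hX (φ k))
  · exact isClosed_setOf_posSemidef.mem_of_tendsto (hXlim.sub (l1.comp hφ.tendsto_atTop))
      (.of_forall fun k => h1 (φ k))
  · exact isClosed_setOf_posSemidef.mem_of_tendsto
      ((((continuous_partialTraceRight.tendsto _).comp hXlim).sub tendsto_const_nhds).sub
        (l2.comp hφ.tendsto_atTop)) (.of_forall fun k => h2 (φ k))
  · exact isClosed_setOf_posSemidef.mem_of_tendsto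
      (((hblock.tendsto _).comp hXlim).sub (l3.comp hφ.tendsto_atTop))
      (.of_forall fun k => h3 (φ k))

/-- If no operator below the geometric mean of `P` and `Q` has partial trace at least `μ`, then the
dual program has a feasible point with value below `μ`. -/
theorem exists_dual_of_not_exists_primal {P Q : Matrix (A × B) (A × B) ℂ} (hP : P.PosSemidef)
    (hQ : Q.PosSemidef) {μ : ℝ}
    (h : ¬ ∃ X, IsSubMean P X Q ∧ (partialTraceRight X - μ • (1 : Matrix A A ℂ)).PosSemidef) :
    ∃ (ρ : Matrix A A ℂ) (Y W Z : Matrix (A × B) (A × B) ℂ), IsState ρ ∧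
      (fromBlocks Y Wᴴ W Z).PosSemidef ∧
      (W + Wᴴ - ρ ⊗ₖ (1 : Matrix B B ℂ)).PosSemidef ∧
      ((P * Y).trace + (Q * Z).trace).re < μ := by
  have h0 : (0 : Matrix (A × B) (A × B) ℂ × Matrix A A ℂ ×
      Matrix ((A × B) ⊕ (A × B)) ((A × B) ⊕ (A × B)) ℂ) ∉ primalSlacks P Q μ := by
    rintro ⟨X, -, h1, h2, h3⟩
    simp only [Prod.fst_zero, Prod.snd_zero, sub_zero] at h1 h2 h3
    exact h ⟨X, ⟨h1, h3⟩, h2⟩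
  obtain ⟨f, u, hf, hu⟩ := geometric_hahn_banach_closed_point (convex_primalSlacks P Q μ)
    (isClosed_primalSlacks P Q μ) h0
  rw [map_zero] at hu
  let f₁ : Matrix (A × B) (A × B) ℂ →ₗ[ℝ] ℝ := f.toLinearMap ∘ₗ LinearMap.inl ℝ _ _
  let f₂ : Matrix A A ℂ →ₗ[ℝ] ℝ :=
    f.toLinearMap ∘ₗ LinearMap.inr ℝ _ _ ∘ₗ LinearMap.inl ℝ _ _
  let f₃ : Matrix ((A × B) ⊕ (A × B)) ((A × B) ⊕ (A × B)) ℂ →ₗ[ℝ] ℝ :=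
    f.toLinearMap ∘ₗ LinearMap.inr ℝ _ _ ∘ₗ LinearMap.inr ℝ _ _
  have hsplit : ∀ x y z, f (x, y, z) = f₁ x + f₂ y + f₃ z := fun x y z => by
    simp only [f₁, f₂, f₃, LinearMap.comp_apply, LinearMap.inl_apply, LinearMap.inr_apply,
      ContinuousLinearMap.coe_coe, ← map_add]
    simp
  -- The value of the separating functional at the slacks of `X = 0`. It lies below `u < 0`.
  set c : ℝ := f₃ (fromBlocks P 0 0 Q) - μ * f₂ 1 with hc
  have hmem : ∀ (X : Matrix (A × B) (A × B) ℂ) (p₁ : Matrix (A × B) (A × B) ℂ)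
      (p₂ : Matrix A A ℂ) (p₃ : Matrix ((A × B) ⊕ (A × B)) ((A × B) ⊕ (A × B)) ℂ),
      X.IsHermitian → p₁.PosSemidef → p₂.PosSemidef → p₃.PosSemidef →
      c + (f₁ X + f₂ (partialTraceRight X) + f₃ (fromBlocks 0 X X 0))
        - (f₁ p₁ + f₂ p₂ + f₃ p₃) < u := fun X p₁ p₂ p₃ hX h1 h2 h3 => by
    have := hf (X - p₁, partialTraceRight X - μ • 1 - p₂, fromBlocks P X X Q - p₃)
      ⟨X, hX, by simpa using h1, by simpa using h2, by simpa using h3⟩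
    have e : fromBlocks P X X Q = fromBlocks P 0 0 Q + fromBlocks 0 X X 0 := by
      simp [fromBlocks_add]
    rw [hsplit, e] at this
    simp only [map_sub, map_add, map_smul, smul_eq_mul] at this
    linarith
  have hz : partialTraceRight (0 : Matrix (A × B) (A × B) ℂ) = 0 := by
    ext
    simp [partialTraceRight]
  have hc0 : c < 0 := by
    have := hmem 0 0 0 0 isHermitian_zero .zero .zero .zero
    simp [hz] at this
    linarith
  obtain ⟨U, hU, hfU⟩ := exists_posSemidef_eq_trace f₁ fun p hp =>
    nonneg_of_forall_sub_mul_lt (c := c) (u := u) fun t ht => by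
      have := hmem 0 (t • p) 0 0 isHermitian_zero (real_smul_posSemidef hp ht) .zero .zero
      simpa [hz] using this
  obtain ⟨ρ, hρ, hfρ⟩ := exists_posSemidef_eq_trace f₂ fun p hp =>
    nonneg_of_forall_sub_mul_lt (c := c) (u := u) fun t ht => by
      have := hmem 0 0 (t • p) 0 isHermitian_zero .zero (real_smul_posSemidef hp ht) .zero
      simpa [hz] using this
  obtain ⟨T, hT, hfT⟩ := exists_posSemidef_eq_trace f₃ fun p hp =>
    nonneg_of_forall_sub_mul_lt (c := c) (u := u) fun t ht => by
      have := hmem 0 0 0 (t • p) isHermitian_zero .zero .zero (real_smul_posSemidef hp ht)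
      simpa [hz] using this
  obtain ⟨Y, V, Z, rfl⟩ : ∃ Y V Z, T = fromBlocks Y V Vᴴ Z :=
    ⟨T.toBlocks₁₁, T.toBlocks₁₂, T.toBlocks₂₂, by
      conv_lhs => rw [← fromBlocks_toBlocks T]
      congr 1
      ext i j
      exact (hT.1.apply _ _).symm⟩
  -- `K` is the gradient of the Lagrangian in `X`. Since `X` ranges over all Hermitian matrices, a
  -- linear term bounded above must vanish; multiplying `K` by `(u - c) / Tr[K²]` would reach `u`
  -- exactly.
  set K := U + ρ ⊗ₖ (1 : Matrix B B ℂ) + V + Vᴴ with hK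
  have hKH : K.IsHermitian := by
    simp only [IsHermitian, hK, conjTranspose_add, hU.1.eq, conjTranspose_kronecker, hρ.1.eq,
      conjTranspose_one, conjTranspose_conjTranspose]
    abel
  have hlin : ∀ X : Matrix (A × B) (A × B) ℂ, X.IsHermitian →
      f₁ X + f₂ (partialTraceRight X) + f₃ (fromBlocks 0 X X 0) = (K * X).trace.re := by
    intro X hX
    have hb : (fromBlocks 0 X X 0).IsHermitian := by
      simp [IsHermitian, fromBlocks_conjTranspose, hX.eq]
    rw [hfU X hX, hfρ _ (partialTraceRight_isHermitian hX), hfT _ hb, ← trace_kronecker_one_mul,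
      fromBlocks_multiply]
    simp only [hK, add_mul, trace_fromBlocks, mul_zero, zero_add, add_zero, trace_add,
      Complex.add_re]
    ring
  have hK0 : K = 0 := by
    by_contra hne
    have hpos : 0 < (K * K).trace.re := by
      have h1 : (Kᴴ * K).trace ≠ 0 := fun h0 => hne (trace_conjTranspose_mul_self_eq_zero_iff.mp h0)
      have h2 := (posSemidef_conjTranspose_mul_self K).trace_nonneg
      rw [hKH.eq] at h1 h2
      exact (Complex.pos_iff.mp (h2.lt_of_ne h1.symm)).1
    have hs : (((u - c) / (K * K).trace.re) • K).IsHermitian := by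
      simp [IsHermitian, conjTranspose_smul, hKH.eq]
    have := hmem _ 0 0 0 hs .zero .zero .zero
    rw [hlin _ hs, Matrix.mul_smul, trace_smul, Complex.smul_re, smul_eq_mul,
      div_mul_cancel₀ _ hpos.ne'] at this
    simp at this
  have hP1 := posSemidef_of_fromBlocks₁₁ hT
  have hZ1 := posSemidef_of_fromBlocks₂₂ hT
  have hcval : c = (P * Y).trace.re + (Q * Z).trace.re - μ * ρ.trace.re := by
    rw [hc, hfρ _ isHermitian_one, hfT _ (isSubMean_zero hP hQ).2.1, fromBlocks_multiply]
    simp [trace_fromBlocks, trace_mul_comm Y, trace_mul_comm Z]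
  have hYP := re_trace_mul_nonneg hP hP1
  have hZQ := re_trace_mul_nonneg hQ hZ1
  obtain ⟨hr0, hrim⟩ := Complex.nonneg_iff.mp hρ.trace_nonneg
  set r := ρ.trace.re with hr
  -- If `Tr ρ = 0`, then `c` would be a sum of nonnegative terms, contradicting `c < 0`. So the
  -- multipliers can be normalised by `r`.
  have hrpos : 0 < r := by
    refine hr0.lt_of_ne fun hr' => ?_
    rw [← hr'] at hcval
    linarith
  have hrinv : 0 ≤ r⁻¹ := (inv_pos.mpr hrpos).le
  -- `K = 0` reads `-V - Vᴴ - ρ ⊗ 1 = U ≥ 0`, hence the sign of `W`. Congruence by `diag(1, -1)`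
  -- flips the corners, and `c < 0` is the value bound.
  refine ⟨r⁻¹ • ρ, r⁻¹ • Y, r⁻¹ • -Vᴴ, r⁻¹ • Z, ⟨real_smul_posSemidef hρ hrinv, ?_⟩, ?_, ?_, ?_⟩
  · rw [trace_smul, Complex.ext_iff]
    simp [← hrim, ← hr, hrpos.ne']
  · have := hT.mul_mul_conjTranspose_same
      (fromBlocks (1 : Matrix (A × B) (A × B) ℂ) 0 0 (-1 : Matrix (A × B) (A × B) ℂ))
    convert real_smul_posSemidef this hrinv using 1
    simp [fromBlocks_multiply, fromBlocks_conjTranspose, fromBlocks_smul]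
  · have : U = -Vᴴ + (-Vᴴ)ᴴ - ρ ⊗ₖ (1 : Matrix B B ℂ) := by
      rw [← sub_eq_zero, ← hK0, hK]
      simp
      abel
    convert real_smul_posSemidef hU hrinv using 1
    rw [this, conjTranspose_smul, smul_kronecker, star_trivial, smul_sub, smul_add]
  · rw [Matrix.mul_smul, Matrix.mul_smul, trace_smul, trace_smul, Complex.add_re, Complex.smul_re,
      Complex.smul_re, smul_eq_mul, smul_eq_mul, ← mul_add, inv_mul_lt_iff₀ hrpos]
    linarith

end Duality

/-! ### Weak duality. -/

section WeakDuality

variable {n : Type*} [Fintype n]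

/-- Pairing the primal block with the dual block after flipping its corners gives `Tr[X (W + Wᴴ)] ≤
Tr[P Y] + Tr[Q Z]`; then `X ≥ 0` is paired with `W + Wᴴ ≥ R`. -/
theorem re_trace_le_of_dual {P X Q Y W Z R : Matrix n n ℂ} (hX : IsSubMean P X Q)
    (hD : (fromBlocks Y Wᴴ W Z).PosSemidef) (hW : (W + Wᴴ - R).PosSemidef) :
    (R * X).trace.re ≤ (P * Y).trace.re + (Q * Z).trace.re := by
  classical
  have h1 := hD.mul_mul_conjTranspose_same
    (fromBlocks (1 : Matrix n n ℂ) 0 0 (-1 : Matrix n n ℂ))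
  have h2 := re_trace_mul_nonneg hX.2 h1
  have h3 := re_trace_mul_nonneg hW hX.1
  simp only [fromBlocks_multiply, fromBlocks_conjTranspose, trace_fromBlocks, conjTranspose_one,
    conjTranspose_zero, conjTranspose_neg, one_mul, zero_mul, mul_zero, mul_one, add_zero, zero_add,
    neg_mul, mul_neg, neg_neg, trace_add, trace_neg, Complex.add_re, Complex.neg_re, sub_mul,
    add_mul, trace_sub, Complex.sub_re] at h2 h3
  rw [trace_mul_comm X W, trace_mul_comm X Wᴴ] at h2
  linarith

end WeakDuality

/-! ### The channel divergence as the value of the programs, and the exponents. -/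

section ChannelValue

variable {A B : Type*} [Fintype A] [DecidableEq A] [Fintype B] [DecidableEq B]
  {N M : Matrix A A ℂ →ₗ[ℂ] Matrix B B ℂ}

theorem primal_le_dual {μ v : ℝ} (hμ : μ ∈ primalValues N M) (hv : v ∈ dualValues N M) :
    μ ≤ v := by
  obtain ⟨-, X, hX, hμX⟩ := mem_primalValues_iff.mp hμ
  obtain ⟨ρ, Y, W, Z, hρ, hD, hW, rfl⟩ := hv
  have h1 := re_trace_le_of_dual hX hD hW
  have h2 := re_trace_mul_nonneg hρ.1 hμX
  rw [mul_sub, trace_sub, ← trace_kronecker_one_mul, Matrix.mul_smul, mul_one, trace_smul,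
    hρ.2] at h2
  simp at h2
  rw [Complex.add_re]
  linarith

omit [DecidableEq B] in
theorem zero_mem_primalValues (hN : IsChannel N) (hM : IsChannel M) : 0 ∈ primalValues N M := by
  refine mem_primalValues_iff.mpr ⟨le_rfl, 0,
    isSubMean_zero (choi_posSemidef hN.1) (choi_posSemidef hM.1), ?_⟩
  have : partialTraceRight (0 : Matrix (A × B) (A × B) ℂ) = 0 := by
    ext
    simp [partialTraceRight]
  simp [this, PosSemidef.zero]

/-- The pure input with amplitude matrix `K` is the maximally entangled vector acted on by `K` on
the reference, which commutes with the channel. -/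
theorem ampl_vecMulVec {R : Type*} (K : Matrix R A ℂ) :
    ampl R N (vecMulVec (fun p : R × A => K p.1 p.2) (star fun p : R × A => K p.1 p.2))
      = (K ⊗ₖ (1 : Matrix B B ℂ)) * choi N * (K ⊗ₖ (1 : Matrix B B ℂ))ᴴ := by
  rw [ampl_eq_contract]
  ext ⟨r, b⟩ ⟨r', b'⟩
  simp only [contract, of_apply, vecMulVec_apply, Pi.star_apply, mul_apply, conjTranspose_kronecker,
    kroneckerMap_apply, conjTranspose_one, conjTranspose_apply, one_apply, Fintype.sum_prod_type,
    mul_ite, ite_mul, mul_one, mul_zero, zero_mul, Finset.sum_ite_eq, Finset.sum_ite_eq',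
    Finset.mem_univ, if_true, Finset.sum_mul]
  rw [Finset.sum_comm]
  refine Finset.sum_congr rfl fun a _ => Finset.sum_congr rfl fun a' _ => by ring

/-- A dual feasible point with invertible `ρ` bounds the value of the pure input state that
purifies `ρ`. -/
theorem exists_state_le_of_dual {ρ : Matrix A A ℂ} {Y W Z : Matrix (A × B) (A × B) ℂ}
    (hN : IsChannel N) (hM : IsChannel M)
    (hρ : ρ.PosDef) (hρ1 : ρ.trace = 1) (hD : (fromBlocks Y Wᴴ W Z).PosSemidef)
    (hW : (W + Wᴴ - ρ ⊗ₖ (1 : Matrix B B ℂ)).PosSemidef) :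
    ∃ (d : ℕ) (ψ : Matrix (Fin d × A) (Fin d × A) ℂ), IsState ψ ∧
      sSup (subMeanTraces (ampl (Fin d) N ψ) (ampl (Fin d) M ψ)) ≤
        ((choi N * Y).trace + (choi M * Z).trace).re := by
  set S := mpow ρ (1 / 2)
  have hSS : S * S = ρ := mpow_half_mul_self hρ.posSemidef
  have hSH : Sᴴ = S := mpow_isHermitian ρ _
  have hSL : S * (S * ρ⁻¹) = 1 := by
    rw [← Matrix.mul_assoc, hSS, mul_nonsing_inv _ ((isUnit_iff_isUnit_det _).mp hρ.isUnit)]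
  let e : Fin (Fintype.card A) ≃ A := (Fintype.equivFin A).symm
  -- `K` is `ρ ^ (1/2)` with rows relabelled by `Fin`, and `L` is its inverse. Witnesses for the
  -- outputs pull back along `L ⊗ 1` to witnesses for the Choi operators, and `Kᴴ K = ρ` turns the
  -- pairing with `ρ ⊗ 1` into the original trace.
  set K : Matrix (Fin (Fintype.card A)) A ℂ := S.submatrix e id with hK
  set L : Matrix A (Fin (Fintype.card A)) ℂ := (S * ρ⁻¹).submatrix id e with hL
  have hKK : Kᴴ * K = ρ := by
    rw [hK, conjTranspose_submatrix, submatrix_mul_equiv, hSH, hSS, submatrix_id_id]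
  have hLK : L * K = 1 := by
    rw [hK, hL, submatrix_mul_equiv, mul_eq_one_comm.mp hSL, submatrix_id_id]
  have hKL : K * L = 1 := by
    have := submatrix_mul_equiv S (S * ρ⁻¹) e (Equiv.refl A) e
    rw [hSL, submatrix_one_equiv] at this
    exact this
  have hLK' : (L ⊗ₖ (1 : Matrix B B ℂ)) * (K ⊗ₖ (1 : Matrix B B ℂ)) = 1 := by
    rw [← mul_kronecker_mul, hLK, one_mul, one_kronecker_one]
  have hKL' : (K ⊗ₖ (1 : Matrix B B ℂ)) * (L ⊗ₖ (1 : Matrix B B ℂ)) = 1 := by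
    rw [← mul_kronecker_mul, hKL, one_mul, one_kronecker_one]
  have hKK' : (K ⊗ₖ (1 : Matrix B B ℂ))ᴴ * (K ⊗ₖ (1 : Matrix B B ℂ)) = ρ ⊗ₖ 1 := by
    rw [conjTranspose_kronecker, ← mul_kronecker_mul, hKK, conjTranspose_one, one_mul]
  have hcancel : ∀ T : Matrix (A × B) (A × B) ℂ, (L ⊗ₖ (1 : Matrix B B ℂ)) *
      ((K ⊗ₖ (1 : Matrix B B ℂ)) * T * (K ⊗ₖ (1 : Matrix B B ℂ))ᴴ) *
      (L ⊗ₖ (1 : Matrix B B ℂ))ᴴ = T := fun T => by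
    calc _ = ((L ⊗ₖ (1 : Matrix B B ℂ)) * (K ⊗ₖ (1 : Matrix B B ℂ))) * T *
          ((L ⊗ₖ (1 : Matrix B B ℂ)) * (K ⊗ₖ (1 : Matrix B B ℂ)))ᴴ := by
          rw [conjTranspose_mul]
          simp only [Matrix.mul_assoc]
      _ = T := by rw [hLK', conjTranspose_one, one_mul, mul_one]
  set ψ := vecMulVec (fun p : Fin (Fintype.card A) × A => K p.1 p.2)
    (star fun p : Fin (Fintype.card A) × A => K p.1 p.2)
  have hψ : IsState ψ := by
    refine ⟨posSemidef_vecMulVec_self_star _, ?_⟩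
    rw [trace_vecMulVec, ← hρ1, ← hKK, trace_mul_comm]
    simp [dotProduct, Matrix.trace, mul_apply, Fintype.sum_prod_type]
  refine ⟨_, ψ, hψ, csSup_le
    ⟨0, zero_mem_subMeanTraces (hN.1 _ _ hψ.1) (hM.1 _ _ hψ.1)⟩ ?_⟩
  rintro _ ⟨X, hX, rfl⟩
  rw [ampl_vecMulVec, ampl_vecMulVec] at hX
  have hX' := hX.congr (L ⊗ₖ (1 : Matrix B B ℂ))
  rw [hcancel, hcancel] at hX'
  have h1 := re_trace_le_of_dual hX' hD hW
  have h2 : ((ρ ⊗ₖ (1 : Matrix B B ℂ)) * ((L ⊗ₖ (1 : Matrix B B ℂ)) * X *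
      (L ⊗ₖ (1 : Matrix B B ℂ))ᴴ)).trace = X.trace := by
    rw [← hKK', Matrix.mul_assoc, trace_mul_comm]
    calc _ = (((K ⊗ₖ (1 : Matrix B B ℂ)) * (L ⊗ₖ (1 : Matrix B B ℂ))) * X *
          ((K ⊗ₖ (1 : Matrix B B ℂ)) * (L ⊗ₖ (1 : Matrix B B ℂ)))ᴴ).trace := by
          rw [conjTranspose_mul]
          simp only [Matrix.mul_assoc]
      _ = X.trace := by rw [hKL', conjTranspose_one, one_mul, mul_one]
  rwa [h2, ← Complex.add_re] at h1

/-- Mixing with the maximally mixed state makes the state of a dual feasible point invertible, at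
arbitrarily small cost. -/
theorem exists_posDef_dual_lt [Nonempty A] (hN : IsChannel N) (hM : IsChannel M) {v t : ℝ}
    (hv : v ∈ dualValues N M) (hvt : v < t) :
    ∃ (ρ : Matrix A A ℂ) (Y W Z : Matrix (A × B) (A × B) ℂ), ρ.PosDef ∧ ρ.trace = 1 ∧
      (fromBlocks Y Wᴴ W Z).PosSemidef ∧
      (W + Wᴴ - ρ ⊗ₖ (1 : Matrix B B ℂ)).PosSemidef ∧
      ((choi N * Y).trace + (choi M * Z).trace).re < t := by
  obtain ⟨ρ, Y, W, Z, hρ, hD, hW, rfl⟩ := hv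
  set v := ((choi N * Y).trace + (choi M * Z).trace).re with hv
  obtain ⟨δ, hδ0, hδ1, hδ⟩ : ∃ δ : ℝ, 0 < δ ∧ δ < 1 ∧ (1 - δ) * v + δ < t := by
    have hc : Continuous fun δ : ℝ => (1 - δ) * v + δ := by fun_prop
    have h0 : ∀ᶠ δ in 𝓝[>] (0 : ℝ), (1 - δ) * v + δ < t :=
      (hc.tendsto' 0 v (by simp)).mono_left nhdsWithin_le_nhds |>.eventually_lt_const hvt
    obtain ⟨δ, h1, h2⟩ := (h0.and (Ioo_mem_nhdsGT one_pos)).exists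
    exact ⟨δ, h2.1, h2.2, h1⟩
  have hd : (0 : ℝ) < Fintype.card A := by exact_mod_cast Fintype.card_pos
  set a : ℝ := 1 - δ with ha
  set b : ℝ := δ / Fintype.card A with hb
  have ha0 : 0 < a := by linarith
  have hb0 : 0 < b := by positivity
  have hbd : b * Fintype.card A = δ := by rw [hb]; field_simp
  -- `[[1, 1], [1, 1]] ≥ 0`, and adding `b / 2` to `W` raises `W + Wᴴ` by exactly the `b` added to
  -- `ρ`. Both Choi operators have trace `|A|`, so the cost is `b |A| = δ`, which also restores `Tr
  -- ρ = 1`.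
  refine ⟨a • ρ + b • 1, a • Y + (b / 2) • 1, a • W + (b / 2) • 1, a • Z + (b / 2) • 1,
    ?_, ?_, ?_, ?_, ?_⟩
  · refine PosDef.posSemidef_add (real_smul_posSemidef hρ.1 ha0.le) ?_
    have := (PosDef.one (n := A) (R := ℂ)).smul (a := (b : ℂ)) (by simpa using hb0)
    rwa [Complex.coe_smul] at this
  · rw [trace_add, trace_smul, trace_smul, hρ.2, trace_one, Complex.real_smul, Complex.real_smul]
    have : ((b : ℂ) * Fintype.card A) = δ := by exact_mod_cast hbd
    rw [this, ha]
    push_cast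
    ring
  · have h1 := (isSubMean_self (PosSemidef.one (n := A × B) (R := ℂ))).2
    have := (real_smul_posSemidef hD ha0.le).add (real_smul_posSemidef h1 (t := b / 2) (by positivity))
    convert this using 1
    simp [fromBlocks_smul, fromBlocks_add, conjTranspose_smul]
  · convert real_smul_posSemidef hW ha0.le using 1
    rw [add_kronecker, smul_kronecker, smul_kronecker, one_kronecker_one, conjTranspose_add,
      conjTranspose_smul, conjTranspose_smul, conjTranspose_one, star_trivial, star_trivial]
    module
  · have e : ((choi N * (a • Y + (b / 2) • 1)).trace + (choi M * (a • Z + (b / 2) • 1)).trace).re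
        = a * v + b * Fintype.card A := by
      simp only [mul_add, Matrix.mul_smul, mul_one, trace_add, trace_smul, trace_choi hN.2,
        trace_choi hM.2, hv, Complex.add_re, Complex.smul_re, smul_eq_mul, Complex.natCast_re]
      ring
    rw [e, hbd]
    exact hδ

theorem exists_mem_dualValues_lt (hN : IsChannel N) (hM : IsChannel M) {μ : ℝ} (hμ : 0 ≤ μ)
    (h : μ ∉ primalValues N M) : ∃ v ∈ dualValues N M, v < μ := by
  obtain ⟨ρ, Y, W, Z, hρ, hD, hW, hlt⟩ := exists_dual_of_not_exists_primal (μ := μ)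
    (choi_posSemidef hN.1) (choi_posSemidef hM.1) fun ⟨X, hX, hμX⟩ =>
      h (mem_primalValues_iff.mpr ⟨hμ, X, hX, by rwa [Complex.coe_smul]⟩)
  exact ⟨_, ⟨ρ, Y, W, Z, hρ, hD, hW, rfl⟩, hlt⟩

omit [DecidableEq B] in
-- Taking traces, `μ |A| ≤ Tr X ≤ (Tr Γ^N + Tr Γ^M) / 2 = |A|`. Any larger `μ`, such as `2`, is thus
-- infeasible and produces a dual feasible point.
theorem primalValues_le_one [Nonempty A] (hN : IsChannel N) (hM : IsChannel M) {μ : ℝ}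
    (hμ : μ ∈ primalValues N M) : μ ≤ 1 := by
  obtain ⟨-, X, hX, hμX⟩ := mem_primalValues_iff.mp hμ
  have hd : (0 : ℝ) < Fintype.card A := by exact_mod_cast Fintype.card_pos
  have h1 := re_trace_le_of_fromBlocks hX.2
  have h2 := (Complex.nonneg_iff.mp hμX.trace_nonneg).1
  have h3 : (partialTraceRight X).trace = X.trace := by
    simp [Matrix.trace, partialTraceRight, Fintype.sum_prod_type]
  rw [trace_choi hN.2, trace_choi hM.2] at h1
  rw [trace_sub, h3, trace_smul, trace_one] at h2
  simp at h1 h2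
  nlinarith

/-- Strong duality: the primal and the dual program have the same value. -/
theorem exists_isLUB_primalValues_isGLB_dualValues [Nonempty A] (hN : IsChannel N) (hM : IsChannel M) :
    ∃ s : ℝ, 0 ≤ s ∧ IsLUB (primalValues N M) s ∧ IsGLB (dualValues N M) s := by
  have h0 := zero_mem_primalValues hN hM
  obtain ⟨v₀, hv₀, -⟩ := exists_mem_dualValues_lt hN hM (μ := 2) (by norm_num) fun h =>
    absurd (primalValues_le_one hN hM h) (by norm_num)
  have hlub : IsLUB (primalValues N M) (sSup (primalValues N M)) :=
    isLUB_csSup ⟨0, h0⟩ ⟨v₀, fun μ hμ => primal_le_dual hμ hv₀⟩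
  refine ⟨_, hlub.1 h0, hlub, fun v hv => hlub.2 fun μ hμ => primal_le_dual hμ hv, fun b hb => ?_⟩
  by_contra! hlt
  obtain ⟨v, hv, hvb⟩ := exists_mem_dualValues_lt hN hM ((hlub.1 h0).trans hlt.le)
    fun h => absurd (hlub.1 h) (not_le.mpr hlt)
  exact absurd (hb hv) (not_le.mpr hvb)

theorem geometricRenyi_half {n : Type*} [Fintype n] [DecidableEq n] {P Q : Matrix n n ℂ}
    (hP : P.PosSemidef) (hQ : Q.PosSemidef) :
    geometricRenyi (1 / 2) P Q =
      ((-2 : ℝ) : EReal) * ENNReal.log (ENNReal.ofReal (sSup (subMeanTraces P Q))) := by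
  rw [geometricRenyi, geometricQuasi_half hP hQ]
  norm_num

theorem neg_two_mul_log_ofReal (x : ℝ) :
    ((-2 : ℝ) : EReal) * ENNReal.log (ENNReal.ofReal x) =
      if x ≤ 0 then ⊤ else ((-2 * Real.log x : ℝ) : EReal) := by
  rw [ENNReal.log_ofReal]
  split_ifs
  · exact EReal.coe_mul_bot_of_neg (by norm_num)
  · rw [EReal.coe_mul]

theorem neg_two_mul_log_ofReal_anti {x y : ℝ} (h : x ≤ y) :
    ((-2 : ℝ) : EReal) * ENNReal.log (ENNReal.ofReal y) ≤
      ((-2 : ℝ) : EReal) * ENNReal.log (ENNReal.ofReal x) := by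
  rw [neg_two_mul_log_ofReal, neg_two_mul_log_ofReal]
  split_ifs with hy hx hx
  · exact le_rfl
  · exact absurd (h.trans hy) hx
  · exact le_top
  · rw [EReal.coe_le_coe_iff]
    have := Real.log_le_log (not_le.mp hx) h
    linarith

/-- Right continuity of `-2 ln` at `s`, with value `⊤` at `0`. It is needed because dual points with
invertible `ρ` only give values approaching `s` from above. -/
theorem neg_two_mul_log_ofReal_le {s : ℝ} {r : EReal} (hs : 0 ≤ s)
    (h : ∀ t > s, ((-2 : ℝ) : EReal) * ENNReal.log (ENNReal.ofReal t) ≤ r) :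
    ((-2 : ℝ) : EReal) * ENNReal.log (ENNReal.ofReal s) ≤ r := by
  have h' : ∀ t > s, ((-2 * Real.log t : ℝ) : EReal) ≤ r := fun t ht => by
    have := h t ht
    rwa [neg_two_mul_log_ofReal, if_neg (not_le.mpr (hs.trans_lt ht))] at this
  rw [neg_two_mul_log_ofReal]
  split_ifs with h0
  · have hs0 : s = 0 := le_antisymm h0 hs
    rw [top_le_iff, EReal.eq_top_iff_forall_lt]
    intro y
    have := h' (Real.exp (-(y + 1) / 2)) (by rw [hs0]; positivity)
    rw [Real.log_exp] at this
    refine lt_of_lt_of_le ?_ this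
    rw [EReal.coe_lt_coe_iff]
    linarith
  · have hc : ContinuousAt (fun t => -2 * Real.log t) s :=
      continuousAt_const.mul (Real.continuousAt_log (not_le.mp h0).ne')
    have h1 : Tendsto (fun t => ((-2 * Real.log t : ℝ) : EReal)) (𝓝[>] s)
        (𝓝 ((-2 * Real.log s : ℝ) : EReal)) :=
      (continuous_coe_real_ereal.tendsto _).comp (hc.mono_left nhdsWithin_le_nhds)
    exact le_of_tendsto h1 (eventually_mem_nhdsWithin.mono h')

theorem channelGeometricRenyi_half [Nonempty A] (hN : IsChannel N) (hM : IsChannel M) {s : ℝ}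
    (hs : 0 ≤ s) (hlub : IsLUB (primalValues N M) s) (hglb : IsGLB (dualValues N M) s) :
    channelGeometricRenyi (1 / 2) N M =
      ((-2 : ℝ) : EReal) * ENNReal.log (ENNReal.ofReal s) := by
  apply le_antisymm
  · refine iSup_le fun d => iSup_le fun ρ => iSup_le fun hρ => ?_
    rw [geometricRenyi_half (hN.1 d ρ hρ.1) (hM.1 d ρ hρ.1)]
    refine neg_two_mul_log_ofReal_anti (hlub.2 fun μ hμ => ?_)
    obtain ⟨X, hX, hXt⟩ := exists_isSubMean_ampl hμ (isSubMean_self hρ.1)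
    rw [hρ.2, Complex.one_re, mul_one] at hXt
    exact hXt.trans (le_csSup (subMeanTraces_bddAbove _ _) ⟨X, hX, rfl⟩)
  · refine neg_two_mul_log_ofReal_le hs fun t ht => ?_
    obtain ⟨v, hv, -, hvt⟩ := hglb.exists_between ht
    obtain ⟨ρ, Y, W, Z, hρ, hρ1, hD, hW, hlt⟩ := exists_posDef_dual_lt hN hM hv hvt
    obtain ⟨d, ψ, hψ, hle⟩ := exists_state_le_of_dual hN hM hρ hρ1 hD hW
    refine le_trans ?_ (le_iSup_of_le d (le_iSup_of_le ψ (le_iSup_of_le hψ le_rfl)))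
    rw [geometricRenyi_half (hN.1 d ψ hψ.1) (hM.1 d ψ hψ.1)]
    exact neg_two_mul_log_ofReal_anti (hle.trans hlt.le)

theorem optErrorProb_ge [Nonempty A] (hN : IsChannel N) (hM : IsChannel M) {n : ℕ} (hn : 1 ≤ n)
    {p : ℝ} (hp0 : 0 < p) (hp1 : p < 1) {s : ℝ} (hlub : IsLUB (primalValues N M) s) :
    p * (1 - p) * (s ^ n) ^ 2 ≤ optErrorProb n p N M := by
  obtain ⟨S⟩ := exists_strategy (A := A) (B := B) n
  refine le_csInf ⟨_, S, 0, ⟨.zero, by rw [sub_zero]; exact .one⟩, rfl⟩ ?_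
  rintro _ ⟨S, T, hT, rfl⟩
  -- The bound is closed in `μ`, so it passes to the supremum `s` without asking whether `s` is
  -- attained.
  have hcl : IsClosed {x : ℝ | p * (1 - p) * (x ^ n) ^ 2 ≤ errorProb p N M S T} :=
    isClosed_le (by fun_prop) continuous_const
  exact closure_minimal (fun μ hμ => errorProb_ge hN hM hn hp0 hp1 hμ S hT) hcl
    (hlub.mem_closure ⟨0, zero_mem_primalValues hN hM⟩)

theorem chernoffExponent_le [Nonempty A] (hN : IsChannel N) (hM : IsChannel M) {n : ℕ}
    (hn : 1 ≤ n) {p : ℝ} (hp0 : 0 < p) (hp1 : p < 1) {s : ℝ} (hs : 0 < s)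
    (hlub : IsLUB (primalValues N M) s) :
    chernoffExponent n p N M ≤
      ((-2 * Real.log s + -(1 / (n : ℝ)) * Real.log (p * (1 - p)) : ℝ) : EReal) := by
  have hpp : 0 < p * (1 - p) := mul_pos hp0 (sub_pos.mpr hp1)
  have hsn : 0 < s ^ n := pow_pos hs n
  have hge := optErrorProb_ge hN hM hn hp0 hp1 hlub
  have hlow : 0 < p * (1 - p) * (s ^ n) ^ 2 := by positivity
  have hlog := Real.log_le_log hlow hge
  rw [Real.log_mul hpp.ne' (by positivity), Real.log_pow, Real.log_pow] at hlog
  rw [chernoffExponent, ENNReal.log_ofReal_of_pos (hlow.trans_le hge), ← EReal.coe_mul,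
    EReal.coe_le_coe_iff]
  have hn0 : (0 : ℝ) < n := by exact_mod_cast hn
  have := mul_le_mul_of_nonneg_left hlog (one_div_pos.mpr hn0).le
  have e : 1 / (n : ℝ) * (Real.log (p * (1 - p)) + (2 : ℕ) * (n * Real.log s))
      = 1 / (n : ℝ) * Real.log (p * (1 - p)) + 2 * Real.log s := by
    push_cast
    field_simp
  rw [e] at this
  linarith

theorem asymptoticChernoffExponent_le [Nonempty A] (hN : IsChannel N) (hM : IsChannel M)
    {p : ℝ} (hp0 : 0 < p) (hp1 : p < 1) {s : ℝ} (hs : 0 < s)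
    (hlub : IsLUB (primalValues N M) s) :
    asymptoticChernoffExponent p N M ≤ ((-2 * Real.log s : ℝ) : EReal) := by
  have hlim : Tendsto (fun n : ℕ => ((-2 * Real.log s
      + -(1 / (n : ℝ)) * Real.log (p * (1 - p)) : ℝ) : EReal)) atTop
      (𝓝 ((-2 * Real.log s : ℝ) : EReal)) := by
    refine (continuous_coe_real_ereal.tendsto _).comp ?_
    have h := (tendsto_one_div_atTop_nhds_zero_nat (𝕜 := ℝ)).neg.mul_const
      (Real.log (p * (1 - p)))
    simpa using h.const_add (-2 * Real.log s)
  rw [asymptoticChernoffExponent, ← hlim.limsup_eq]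
  refine limsup_le_limsup ?_
  filter_upwards [eventually_ge_atTop 1] with n hn
  exact chernoffExponent_le hN hM hn hp0 hp1 hs hlub

end ChannelValue

end ChannelDiscrimination

theorem mainTheorem8 {A B : Type*} [Fintype A] [DecidableEq A] [Nonempty A]
    [Fintype B] [DecidableEq B]
    (N M : Matrix A A ℂ →ₗ[ℂ] Matrix B B ℂ)
    (hN : ChannelDiscrimination.IsChannel N) (hM : ChannelDiscrimination.IsChannel M) :
    (∀ p : ℝ, 0 < p → p < 1 →
      (∀ n : ℕ, 1 ≤ n →
        ChannelDiscrimination.chernoffExponent n p N M ≤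
          ChannelDiscrimination.channelGeometricRenyi (1 / 2) N M
            + ((-(1 / (n : ℝ)) * Real.log (p * (1 - p)) : ℝ) : EReal)) ∧
      ChannelDiscrimination.asymptoticChernoffExponent p N M ≤
        ChannelDiscrimination.channelGeometricRenyi (1 / 2) N M) ∧
    ∃ s : ℝ,
      IsLUB (ChannelDiscrimination.primalValues N M) s ∧
      IsGLB (ChannelDiscrimination.dualValues N M) s ∧
      ChannelDiscrimination.channelGeometricRenyi (1 / 2) N M =
        ((-2 : ℝ) : EReal) * ENNReal.log (ENNReal.ofReal s) := by
  obtain ⟨s, hs, hlub, hglb⟩ :=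
    ChannelDiscrimination.exists_isLUB_primalValues_isGLB_dualValues hN hM
  have hR := ChannelDiscrimination.channelGeometricRenyi_half hN hM hs hlub hglb
  refine ⟨fun p hp0 hp1 => ?_, s, hlub, hglb, hR⟩
  rw [hR, ChannelDiscrimination.neg_two_mul_log_ofReal]
  split_ifs with h0
  -- When `s = 0` the divergence is `⊤` and both bounds are trivial.
  · exact ⟨fun n _ => by rw [EReal.top_add_coe]; exact le_top, le_top⟩
  · refine ⟨fun n hn => ?_, ChannelDiscrimination.asymptoticChernoffExponent_le hN hM hp0 hp1
      (not_le.mp h0) hlub⟩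
    rw [← EReal.coe_add]
    exact ChannelDiscrimination.chernoffExponent_le hN hM hn hp0 hp1 (not_le.mp h0) hlub
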